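/- Let $d\ge 0$ be an integer and let $P\subset\mathbb{R}^d$ be a two-dimensional lattice polytope (a lattice polygon), that is, a convex polytope whose affine hull has dimension $2$ and whose vertices all lie in $\mathbb{Z}^d$. Then there is exactly one polynomial $i_P\in\mathbb{C}[t]$ (the Ehrhart polynomial of $P$) such that $i_P(n)=\#(nP\cap\mathbb{Z}^d)$ for all integers $n\ge 0$, and every complex root of $i_P$ is contained in \[ \left\{-2,\,-1,\,-\tfrac23\right\}\ \cup\ \left\{x+iy\in\mathbb{C} : -\tfrac12\le x<0,\ |y|\le \tfrac{\sqrt{15}}{6}\right\}. \] -/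

import Mathlib

open scoped Pointwise

/-- The point of `ℝ^d` given by an integer vector. -/
def intPoint {d : ℕ} (z : Fin d → ℤ) : Fin d → ℝ := fun i => (z i : ℝ)

/-- A lattice polytope in `ℝ^d`: a convex polytope (the convex hull of finitely many points)
all of whose vertices (extreme points) have integral coordinates. -/
def IsLatticePolytope {d : ℕ} (P : Set (Fin d → ℝ)) : Prop :=
  (∃ S : Set (Fin d → ℝ), S.Finite ∧ P = convexHull ℝ S) ∧
    ∀ v ∈ P.extremePoints ℝ, ∃ z : Fin d → ℤ, v = intPoint z

/-- The dimension of a nonempty polytope: the dimension of its affine hull. -/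
noncomputable def polytopeDim {d : ℕ} (P : Set (Fin d → ℝ)) : ℕ :=
  Module.finrank ℝ (vectorSpan ℝ P)

/-- The number of lattice points in the `n`-fold dilate of `P`. -/
noncomputable def latticePointCount {d : ℕ} (P : Set (Fin d → ℝ)) (n : ℕ) : ℕ :=
  {z : Fin d → ℤ | intPoint z ∈ (n : ℝ) • P}.ncard

/-- `p` is the Ehrhart polynomial of `P`: at every natural number `n` it takes the number of
lattice points of `n P` as its value. -/
def IsEhrhartPolynomial {d : ℕ} (P : Set (Fin d → ℝ)) (p : Polynomial ℂ) : Prop :=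
  ∀ n : ℕ, p.eval (n : ℂ) = (latticePointCount P n : ℂ)

/-! A rational plane meets `ℤ^d` in a rank-two lattice, so everything reduces to a polygon in `ℝ²`
with vertices in `ℤ²` (`IsLatticePolytope.exists_planarCount_eq`). Such a polygon lies between the
graphs of two piecewise affine functions of the ordinate whose breakpoints are lattice points.
Counting its dilates row by row gives sums of integer parts, which are evaluated on each edge by
reflecting the summation index. With `k` boundary points and `i` interior points the result is
Pick's formula together with the Ehrhart polynomial `(i + k/2 - 1) n² + (k/2) n + 1`
(`RowBounds.planarCount_eq`, `RowBounds.exists_counts`).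

The second ingredient is Scott's inequality: if `i ≥ 1`, then `k ≤ 2i + 6`, except possibly for `(k,
i) = (9, 1)`. Among all lattice polygons with the same counts, take one of least height `p`, and let
`q` be the total length of its bottom and top edges. Then `k ≤ q + 2p`. The area is at least `pq/2`.
By minimality no shear has smaller horizontal width than `p`, which gives the further bound `p(p +
q)/4` when `q ≤ p` (`RowBounds.height_mul_le_area`). These bounds yield the inequality by arithmetic
(`boundary_le_of_height`).

The roots can then be read off. If `i = 0` the quadratic has the factor `z + 1`. If `i ≥ 1` its
value at `-1/2` is `(2i + 6 - k)/8`, so Scott's inequality confines the real roots, and non-real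
roots are controlled by `k ≥ 3` and area at least `3/2`. -/

/-! ### Floor sums along lattice segments. -/

/-- The number of integers `y ∈ [a, b)` at which `g` takes an integer value. -/
noncomputable def integralRows (g : ℝ → ℝ) (a b : ℤ) : ℕ := by
  classical exact ((Finset.Ico a b).filter (fun y : ℤ => ∃ x : ℤ, g y = x)).card

lemma card_filter_range_mul_dvd (n q : ℕ) (m : ℤ) :
    ((Finset.range (n * q)).filter (fun k : ℕ => (q : ℤ) ∣ k * m)).card
      = n * ((Finset.range q).filter (fun k : ℕ => (q : ℤ) ∣ k * m)).card := by
  induction n with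
  | zero => simp
  | succ n ih =>
    rw [Finset.card_filter] at ih ⊢
    rw [add_mul, one_mul, Finset.sum_range_add, ih, add_mul, one_mul, add_right_inj,
      Finset.card_filter]
    refine Finset.sum_congr rfl fun k _ => ?_
    have : (q : ℤ) ∣ ((n * q + k : ℕ) : ℤ) * m ↔ (q : ℤ) ∣ k * m := by
      push_cast
      rw [add_mul]
      exact Int.dvd_add_right ⟨n * m, by ring⟩
    simp only [this]

/-- The remainders of `t` and `-t` modulo `q` add up to `0` if `q ∣ t` and to `q` otherwise. -/
lemma ediv_add_ediv_neg {q : ℤ} (hq : 0 < q) (c t : ℤ) :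
    t / q + (q * c - t) / q = c - 1 + if q ∣ t then 1 else 0 := by
  have h : (q * c - t) / q = c + (-t) / q := by
    rw [sub_eq_add_neg, Int.mul_add_ediv_left _ _ hq.ne']
  rw [h]
  split_ifs with hd
  · obtain ⟨s, rfl⟩ := hd
    rw [← mul_neg, Int.mul_ediv_cancel_left _ hq.ne', Int.mul_ediv_cancel_left _ hq.ne']
    ring
  · have h1 := Int.emod_add_mul_ediv t q
    have h2 := Int.emod_add_mul_ediv (-t) q
    have h3 := Int.emod_nonneg t hq.ne'
    have h4 := Int.emod_lt_of_pos t hq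
    have h5 := Int.emod_nonneg (-t) hq.ne'
    have h6 := Int.emod_lt_of_pos (-t) hq
    have h7 : t % q ≠ 0 := fun h0 => hd (Int.dvd_of_emod_eq_zero h0)
    have h8 : q * (t / q + -t / q) = -(t % q + -t % q) := by linarith
    have h9 : -2 < t / q + -t / q := by
      by_contra hc; push Not at hc; nlinarith
    have h10 : t / q + -t / q < 0 := by
      by_contra hc; push Not at hc
      have : 0 < t % q := lt_of_le_of_ne h3 (Ne.symm h7)
      nlinarith
    linarith [show t / q + -t / q = -1 by omega]

/-- Gauss's reflection: the terms at `k` and `nq - k` add up to `nm - 1`, plus `1` when `q ∣ km`,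
and the exceptional `k` recur with period `q`. -/
lemma two_mul_sum_ediv (n q : ℕ) (hq : 0 < q) (m : ℤ) :
    2 * ∑ k ∈ Finset.range (n * q), ((k : ℤ) * m / q) =
      n ^ 2 * q * m - n * m - n * q
        + n * ((Finset.range q).filter (fun k : ℕ => (q : ℤ) ∣ k * m)).card := by
  have hq' : (0 : ℤ) < q := by exact_mod_cast hq
  -- The reflected indices run over `1, …, nq` instead of `0, …, nq - 1`; the end term `nm` is the
  -- difference.
  have h1 : ∑ k ∈ Finset.range (n * q), (((n * q : ℕ) - k : ℤ) * m / q)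
      = ∑ k ∈ Finset.range (n * q), ((k : ℤ) * m / q) + n * m := by
    have e1 := Finset.sum_range_succ (fun k : ℕ => ((k : ℤ) * m / q)) (n * q)
    have e2 := Finset.sum_range_succ' (fun k : ℕ => ((k : ℤ) * m / q)) (n * q)
    have e3 := Finset.sum_range_reflect (fun k : ℕ => (((k + 1 : ℕ) : ℤ) * m / q)) (n * q)
    have e4 : ((n * q : ℕ) : ℤ) * m / q = n * m := by
      push_cast
      rw [show (n : ℤ) * q * m = q * (n * m) by ring, Int.mul_ediv_cancel_left _ hq'.ne']
    rw [e4] at e1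
    rw [e1] at e2
    rw [e2, ← e3]
    simp only [Nat.cast_zero, zero_mul, Int.zero_ediv, add_zero]
    refine Finset.sum_congr rfl fun k hk => ?_
    have := Finset.mem_range.mp hk
    congr 3
    omega
  have h2 : ∑ k ∈ Finset.range (n * q), (((k : ℤ) * m / q) + (((n * q : ℕ) - k : ℤ) * m / q))
      = n * q * (n * m - 1) + n * ((Finset.range q).filter (fun k : ℕ => (q : ℤ) ∣ k * m)).card := by
    have : ∀ k ∈ Finset.range (n * q), (((k : ℤ) * m / q) + (((n * q : ℕ) - k : ℤ) * m / q))
        = (n * m - 1) + if (q : ℤ) ∣ k * m then 1 else 0 := by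
      intro k _
      rw [← ediv_add_ediv_neg hq']
      push_cast
      congr 2
      ring
    rw [Finset.sum_congr rfl this, Finset.sum_add_distrib]
    have h3 := card_filter_range_mul_dvd n q m
    rw [Finset.sum_boole, h3]
    simp only [Finset.sum_const, Finset.card_range, nsmul_eq_mul]
    push_cast
    ring
  rw [Finset.sum_add_distrib, h1] at h2
  linarith

lemma floor_intCast_div_eq (t : ℤ) (q : ℕ) : ⌊(t : ℝ) / q⌋ = t / q := by
  have := Rat.floor_intCast_div_natCast t q
  rw [← this, ← Rat.floor_cast (α := ℝ)]
  simp

/-- A closed formula for the sums of the integer parts of the dilates of `g` over the integers in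
the dilates of `[a, b)`. -/
def HasFloorSum (g : ℝ → ℝ) (a b : ℤ) : Prop :=
  IntervalIntegrable g MeasureTheory.volume a b ∧
    ∀ n : ℕ, ∑ y ∈ Finset.Ico (n * a) (n * b), (⌊n * g (y / n)⌋ : ℝ) =
      n ^ 2 * (∫ t in (a : ℝ)..b, g t) - n * (g b - g a) / 2 - n * (b - a) / 2
        + n * integralRows g a b / 2

lemma sum_Ico_int_consecutive {M : Type*} [AddCommMonoid M] (f : ℤ → M) {a b c : ℤ}
    (hab : a ≤ b) (hbc : b ≤ c) :
    ∑ y ∈ Finset.Ico a b, f y + ∑ y ∈ Finset.Ico b c, f y = ∑ y ∈ Finset.Ico a c, f y := by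
  rw [← Finset.Ico_union_Ico_eq_Ico hab hbc,
    Finset.sum_union (Finset.Ico_disjoint_Ico_consecutive a b c)]

lemma integralRows_add (g : ℝ → ℝ) {a b c : ℤ} (hab : a ≤ b) (hbc : b ≤ c) :
    integralRows g a c = integralRows g a b + integralRows g b c := by
  classical
  simp only [integralRows, Finset.card_filter]
  exact (sum_Ico_int_consecutive _ hab hbc).symm

lemma HasFloorSum.trans {g : ℝ → ℝ} {a b c : ℤ} (hab : a ≤ b) (hbc : b ≤ c)
    (h₁ : HasFloorSum g a b) (h₂ : HasFloorSum g b c) : HasFloorSum g a c := by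
  refine ⟨h₁.1.trans h₂.1, fun n => ?_⟩
  have hn : (0 : ℤ) ≤ n := by positivity
  rw [← sum_Ico_int_consecutive _ (mul_le_mul_of_nonneg_left hab hn)
    (mul_le_mul_of_nonneg_left hbc hn), h₁.2, h₂.2, integralRows_add g hab hbc,
    ← intervalIntegral.integral_add_adjacent_intervals h₁.1 h₂.1]
  push_cast
  ring

lemma sum_Ico_int_eq_sum_range (f : ℤ → ℝ) (c : ℤ) (k : ℕ) :
    ∑ y ∈ Finset.Ico c (c + k), f y = ∑ j ∈ Finset.range k, f (c + j) := by
  refine Finset.sum_nbij' (fun y => (y - c).toNat) (fun j => c + j) ?_ ?_ ?_ ?_ ?_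
  · intro y hy; simp only [Finset.mem_Ico, Finset.mem_range] at *; omega
  · intro y hy; simp only [Finset.mem_Ico, Finset.mem_range] at *; omega
  · intro y hy; simp only [Finset.mem_Ico] at *; omega
  · intro y hy; simp
  · intro y hy; simp only [Finset.mem_Ico] at hy; congr 1; omega

/-- Between lattice endpoints the slope is `m / q` with `m` and `q` integers. The floors in the
`n`-th dilate are those of `km / q` up to an integer shift, and the integral rows correspond to `q ∣
km`. -/
lemma hasFloorSum_of_affine {g : ℝ → ℝ} {a b : ℤ} (hab : a < b) {α : ℝ} {x₀ x₁ : ℤ}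
    (hx : (x₁ : ℝ) = x₀ + (b - a) * α)
    (hg : ∀ t ∈ Set.Icc (a : ℝ) b, g t = x₀ + (t - a) * α) : HasFloorSum g a b := by
  obtain ⟨q, hq⟩ : ∃ q : ℕ, b = a + q := ⟨(b - a).toNat, by omega⟩
  have hq0 : 0 < q := by omega
  have hqR : (0 : ℝ) < q := by exact_mod_cast hq0
  have hbR : (b : ℝ) = a + q := by rw [hq]; push_cast; ring
  have habR : (a : ℝ) ≤ b := by exact_mod_cast hab.le
  obtain ⟨m, hm⟩ : ∃ m : ℤ, m = x₁ - x₀ := ⟨_, rfl⟩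
  have hmR : (m : ℝ) = q * α := by rw [hm]; push_cast; rw [hx, hbR]; ring
  have hα : α = m / q := by rw [hmR]; field_simp
  have hInt : ∫ t in (a : ℝ)..b, g t = q * x₀ + q * m / 2 := by
    have : ∫ t in (a : ℝ)..b, g t = ∫ t in (a : ℝ)..b, (x₀ - a * α + t * α) := by
      apply intervalIntegral.integral_congr
      intro t ht
      rw [Set.uIcc_of_le habR] at ht
      simp only
      rw [hg t ht]; ring
    have hc : Continuous fun t : ℝ => t * α := by fun_prop
    rw [this, intervalIntegral.integral_add (by simp) (hc.intervalIntegrable _ _)]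
    simp only [intervalIntegral.integral_const, intervalIntegral.integral_mul_const, integral_id,
      smul_eq_mul]
    rw [hmR, hbR]; ring
  have hrows : (integralRows g a b : ℤ)
      = ((Finset.range q).filter (fun k : ℕ => (q : ℤ) ∣ k * m)).card := by
    classical
    have h := sum_Ico_int_eq_sum_range (fun y : ℤ => if ∃ x : ℤ, g y = x then 1 else 0) a q
    have : (integralRows g a b : ℝ)
      = ((Finset.range q).filter (fun k : ℕ => (q : ℤ) ∣ k * m)).card := by
      simp only [integralRows, Finset.card_filter]
      push_cast
      rw [hq, h]
      refine Finset.sum_congr rfl fun k hk => ?_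
      have hk' : (k : ℝ) ≤ q := by exact_mod_cast (Finset.mem_range.mp hk).le
      congr 1
      rw [hg _ ⟨by push_cast; linarith [Nat.cast_nonneg (α := ℝ) k], by push_cast; linarith⟩]
      rw [hα, eq_iff_iff]
      constructor
      · rintro ⟨x, hx⟩
        refine ⟨x - x₀, ?_⟩
        have : (k : ℝ) * m = q * (x - x₀) := by
          rw [← hx]; push_cast; field_simp; ring
        exact_mod_cast this
      · rintro ⟨x, hx⟩
        refine ⟨x₀ + x, ?_⟩
        have : (k : ℝ) * m = q * x := by exact_mod_cast hx
        push_cast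
        field_simp
        linarith
    exact_mod_cast this
  refine ⟨?_, fun n => ?_⟩
  · have : IntervalIntegrable (fun t => x₀ + (t - a) * α) MeasureTheory.volume (a : ℝ) b :=
      Continuous.intervalIntegrable (by fun_prop) _ _
    refine this.congr ?_
    rw [Set.uIoc_of_le habR]
    exact fun t ht => (hg t ⟨ht.1.le, ht.2⟩).symm
  · rcases Nat.eq_zero_or_pos n with rfl | hn
    · simp
    have hnR : (0 : ℝ) < n := by exact_mod_cast hn
    have hs := two_mul_sum_ediv n q hq0 m
    have hb : (n : ℤ) * b = n * a + (n * q : ℕ) := by rw [hq]; push_cast; ring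
    rw [hb, sum_Ico_int_eq_sum_range]
    have hterm : ∀ k ∈ Finset.range (n * q),
        ((⌊n * g ((n * a + k : ℤ) / n)⌋ : ℤ) : ℝ) = n * x₀ + (((k : ℤ) * m / q : ℤ) : ℝ) := by
      intro k hk
      have hk' : (k : ℝ) ≤ n * q := by exact_mod_cast (Finset.mem_range.mp hk).le
      have e1 : ((n * a + k : ℤ) : ℝ) / n = a + k / n := by push_cast; field_simp
      have e2 : (k : ℝ) / n ≤ q := by rw [div_le_iff₀ hnR]; linarith
      rw [e1, hg _ ⟨by linarith [div_nonneg (Nat.cast_nonneg (α := ℝ) k) hnR.le], by linarith⟩]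
      have e3 : (n : ℝ) * (x₀ + (a + k / n - a) * α) = ((n * x₀ : ℤ) : ℝ) + ((k * m : ℤ) : ℝ) / q := by
        rw [hα]; push_cast; field_simp; ring
      rw [e3, Int.floor_intCast_add, floor_intCast_div_eq]
      push_cast; rfl
    push_cast at hterm ⊢
    rw [Finset.sum_congr rfl hterm, Finset.sum_add_distrib, hInt]
    have hs' : (2 : ℝ) * ∑ k ∈ Finset.range (n * q), (((k : ℤ) * m / q : ℤ) : ℝ) =
      n ^ 2 * q * m - n * m - n * q + n * integralRows g a b := by
      rw [← hrows] at hs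
      exact_mod_cast hs
    rw [hg b ⟨habR, le_rfl⟩, hg a ⟨le_rfl, habR⟩, hbR, add_sub_cancel_left, ← hmR]
    simp only [Finset.sum_const, Finset.card_range, nsmul_eq_mul]
    push_cast
    linarith

/-! ### Concave hulls of lattice points. -/

/-- On `[a, b]`, `g` is the least concave function whose hypograph contains the points `(y, x)`
with `(x, y) ∈ V`. -/
structure IsUpperHull (V : Finset (ℤ × ℤ)) (a b : ℤ) (g : ℝ → ℝ) : Prop where
  concave : ConcaveOn ℝ (Set.Icc (a : ℝ) b) g
  mem : ∀ v ∈ V, a ≤ v.2 ∧ v.2 ≤ b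
  le : ∀ v ∈ V, (v.1 : ℝ) ≤ g v.2
  least : ∀ α β : ℝ, (∀ v ∈ V, (v.1 : ℝ) ≤ α * v.2 + β) →
    ∀ t ∈ Set.Icc (a : ℝ) b, g t ≤ α * t + β
  exists_left : ∃ v ∈ V, v.2 = a
  exists_right : ∃ v ∈ V, v.2 = b

/-- Concavity with denominators cleared, so that coinciding points are allowed and the result suits
linear arithmetic. -/
lemma ConcaveOn.three_point {s : Set ℝ} {g : ℝ → ℝ} (hg : ConcaveOn ℝ s g) {x y z : ℝ}
    (hx : x ∈ s) (hz : z ∈ s) (hxy : x ≤ y) (hyz : y ≤ z) :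
    (z - y) * g x + (y - x) * g z ≤ (z - x) * g y := by
  rcases hxy.eq_or_lt with rfl | hxy
  · linarith
  rcases hyz.eq_or_lt with rfl | hyz
  · linarith
  have h := hg.slope_anti_adjacent hx hz hxy hyz
  rw [div_le_div_iff₀ (by linarith) (by linarith)] at h
  nlinarith

namespace IsUpperHull

variable {V : Finset (ℤ × ℤ)} {a b : ℤ} {g : ℝ → ℝ}

/-- Take `v` farthest above the chord. The parallel line through `v` dominates `V`, so leastness
makes `g` pass through `v`. Outside the open interval `(c, d)` a concave function cannot exceed the
chord's line, so `v` lies strictly between. -/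
lemma exists_vertex_above (h : IsUpperHull V a b g) {c d : ℤ} (hac : a ≤ c) (hcd : c < d)
    (hdb : d ≤ b) {α β : ℝ} (hc : g c = α * c + β) (hd : g d = α * d + β)
    (hV : ∃ v ∈ V, α * v.2 + β < (v.1 : ℝ)) :
    ∃ v ∈ V, c < v.2 ∧ v.2 < d ∧ g v.2 = v.1 ∧ α * v.2 + β < (v.1 : ℝ) := by
  obtain ⟨w, hw, hwl⟩ := hV
  obtain ⟨v, hv, hmax⟩ := V.exists_max_image (fun v => (v.1 : ℝ) - (α * v.2 + β)) ⟨w, hw⟩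
  have hpos : α * v.2 + β < (v.1 : ℝ) := by have := hmax w hw; linarith
  obtain ⟨hva, hvb⟩ := h.mem v hv
  have hvI : (v.2 : ℝ) ∈ Set.Icc (a : ℝ) b := ⟨by exact_mod_cast hva, by exact_mod_cast hvb⟩
  have hcI : (c : ℝ) ∈ Set.Icc (a : ℝ) b :=
    ⟨by exact_mod_cast hac, by exact_mod_cast (hcd.le.trans hdb)⟩
  have hdI : (d : ℝ) ∈ Set.Icc (a : ℝ) b :=
    ⟨by exact_mod_cast (hac.trans hcd.le), by exact_mod_cast hdb⟩
  have hcd' : (c : ℝ) < d := by exact_mod_cast hcd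
  have hg : g v.2 = v.1 := by
    refine le_antisymm ?_ (h.le v hv)
    have := h.least α (v.1 - α * v.2) (fun u hu => by have := hmax u hu; linarith) _ hvI
    linarith
  refine ⟨v, hv, ?_, ?_, hg, hpos⟩
  · by_contra hlt
    push Not at hlt
    have hlt' : (v.2 : ℝ) ≤ c := by exact_mod_cast hlt
    have := h.concave.three_point hvI hdI hlt' hcd'.le
    rw [hc, hd, hg] at this
    nlinarith [mul_pos (sub_pos.mpr hcd') (sub_pos.mpr hpos)]
  · by_contra hlt
    push Not at hlt
    have hlt' : (d : ℝ) ≤ v.2 := by exact_mod_cast hlt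
    have := h.concave.three_point hcI hvI hcd'.le hlt'
    rw [hc, hd, hg] at this
    nlinarith [mul_pos (sub_pos.mpr hcd') (sub_pos.mpr hpos)]

/-- Induction on `d - c`: if a point of `V` lies above the chord, split at a vertex; otherwise
leastness and concavity force `g` to equal the chord. -/
lemma hasFloorSum_of_int (h : IsUpperHull V a b g) {c d : ℤ} (hac : a ≤ c) (hcd : c < d)
    (hdb : d ≤ b) {x₀ x₁ : ℤ} (hc : g c = x₀) (hd : g d = x₁) : HasFloorSum g c d := by
  induction hk : (d - c).toNat using Nat.strong_induction_on generalizing c d x₀ x₁ with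
  | _ k ih =>
  have hcd' : (c : ℝ) < d := by exact_mod_cast hcd
  have hcd0 : (d : ℝ) - c ≠ 0 := by linarith
  obtain ⟨α, hα⟩ : ∃ α : ℝ, α = (x₁ - x₀) / (d - c) := ⟨_, rfl⟩
  have hα' : α * (d - c) = x₁ - x₀ := by rw [hα]; field_simp
  by_cases hV : ∃ v ∈ V, α * v.2 + (x₀ - α * c) < (v.1 : ℝ)
  · obtain ⟨v, -, hcv, hvd, hgv, -⟩ := h.exists_vertex_above hac hcd hdb
      (by rw [hc]; ring) (by rw [hd]; linarith) hV
    exact (ih _ (by omega) hac hcv (by omega) hc hgv rfl).trans hcv.le hvd.le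
      (ih _ (by omega) (by omega) hvd hdb hgv hd rfl)
  · push Not at hV
    refine hasFloorSum_of_affine hcd (α := α) (x₀ := x₀) (x₁ := x₁) (by linarith) fun t ht => ?_
    have hcI : (c : ℝ) ∈ Set.Icc (a : ℝ) b :=
      ⟨by exact_mod_cast hac, by exact_mod_cast (hcd.le.trans hdb)⟩
    have hdI : (d : ℝ) ∈ Set.Icc (a : ℝ) b :=
      ⟨by exact_mod_cast (hac.trans hcd.le), by exact_mod_cast hdb⟩
    refine le_antisymm ?_ ?_
    · have := h.least _ _ hV t ⟨hcI.1.trans ht.1, ht.2.trans hdI.2⟩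
      linarith
    · have := h.concave.three_point hcI hdI ht.1 ht.2
      rw [hc, hd, show (x₁ : ℝ) = x₀ + α * (d - c) by linarith] at this
      refine le_of_mul_le_mul_left ?_ (sub_pos.mpr hcd')
      linarith

lemma exists_int_left (h : IsUpperHull V a b g) : ∃ x : ℤ, (x, a) ∈ V ∧ g a = x := by
  obtain ⟨w, hw, hwa⟩ := h.exists_left
  have hab : a ≤ b := by have := h.mem w hw; omega
  obtain ⟨v, hv, hmax⟩ := (V.filter (fun v => v.2 = a)).exists_max_image (fun v => v.1)
    ⟨w, by simp [hw, hwa]⟩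
  obtain ⟨hvV, hva⟩ := Finset.mem_filter.mp hv
  obtain ⟨u, -, hu⟩ := V.exists_max_image (fun v => v.1) ⟨w, hw⟩
  refine ⟨v.1, by rw [← hva]; exact hvV, le_antisymm ?_ (by have := h.le v hvV; rwa [hva] at this)⟩
  -- A line through the extreme point `v` of row `a`, steep enough to dominate `V`: all other rows
  -- are at distance at least `1`, and no abscissa exceeds `u.1`.
  have key := h.least (u.1 - v.1) (v.1 - (u.1 - v.1) * a) (fun z hz => ?_) a
    ⟨le_rfl, by exact_mod_cast hab⟩
  · linarith
  · have huv : (v.1 : ℝ) ≤ u.1 := by exact_mod_cast hu v hvV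
    have huz : (z.1 : ℝ) ≤ u.1 := by exact_mod_cast hu z hz
    rcases (h.mem z hz).1.eq_or_lt with hza | hza
    · have : (z.1 : ℝ) ≤ v.1 := by exact_mod_cast hmax z (by simp [hz, hza])
      rw [← hza]; linarith
    · have : (a : ℝ) + 1 ≤ z.2 := by exact_mod_cast hza
      nlinarith

lemma exists_int_right (h : IsUpperHull V a b g) : ∃ x : ℤ, (x, b) ∈ V ∧ g b = x := by
  obtain ⟨w, hw, hwa⟩ := h.exists_right
  have hab : a ≤ b := by have := h.mem w hw; omega
  obtain ⟨v, hv, hmax⟩ := (V.filter (fun v => v.2 = b)).exists_max_image (fun v => v.1)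
    ⟨w, by simp [hw, hwa]⟩
  obtain ⟨hvV, hva⟩ := Finset.mem_filter.mp hv
  obtain ⟨u, -, hu⟩ := V.exists_max_image (fun v => v.1) ⟨w, hw⟩
  refine ⟨v.1, by rw [← hva]; exact hvV, le_antisymm ?_ (by have := h.le v hvV; rwa [hva] at this)⟩
  have key := h.least (v.1 - u.1) (v.1 - (v.1 - u.1) * b) (fun z hz => ?_) b
    ⟨by exact_mod_cast hab, le_rfl⟩
  · linarith
  · have huv : (v.1 : ℝ) ≤ u.1 := by exact_mod_cast hu v hvV
    have huz : (z.1 : ℝ) ≤ u.1 := by exact_mod_cast hu z hz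
    rcases (h.mem z hz).2.eq_or_lt with hza | hza
    · have : (z.1 : ℝ) ≤ v.1 := by exact_mod_cast hmax z (by simp [hz, hza])
      rw [hza]; linarith
    · have : (z.2 : ℝ) + 1 ≤ b := by exact_mod_cast hza
      nlinarith

lemma hasFloorSum (h : IsUpperHull V a b g) (hab : a < b) : HasFloorSum g a b := by
  obtain ⟨x₀, -, h₀⟩ := h.exists_int_left
  obtain ⟨x₁, -, h₁⟩ := h.exists_int_right
  exact h.hasFloorSum_of_int le_rfl hab le_rfl h₀ h₁

end IsUpperHull

lemma ConcaveOn.trapezoid_le_integral {g : ℝ → ℝ} {a b : ℝ} (hab : a ≤ b)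
    (hg : ConcaveOn ℝ (Set.Icc a b) g) (hi : IntervalIntegrable g MeasureTheory.volume a b) :
    (b - a) * (g a + g b) / 2 ≤ ∫ t in a..b, g t := by
  rcases hab.eq_or_lt with rfl | hlt
  · simp
  have h0 : b - a ≠ 0 := by linarith
  obtain ⟨α, hα⟩ : ∃ α : ℝ, α = (g b - g a) / (b - a) := ⟨_, rfl⟩
  have hα' : α * (b - a) = g b - g a := by rw [hα]; field_simp
  have hc : Continuous fun t : ℝ => t * α := by fun_prop
  have hI : ∫ t in a..b, (g a - a * α + t * α) = (b - a) * (g a + g b) / 2 := by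
    rw [intervalIntegral.integral_add (by simp) (hc.intervalIntegrable _ _)]
    simp only [intervalIntegral.integral_const, intervalIntegral.integral_mul_const, integral_id,
      smul_eq_mul]
    rw [show g b = g a + α * (b - a) by linarith]
    ring
  rw [← hI]
  refine intervalIntegral.integral_mono_on hab
    (Continuous.intervalIntegrable (by fun_prop) _ _) hi fun t ht => ?_
  have := hg.three_point ⟨le_rfl, hab⟩ ⟨hab, le_rfl⟩ ht.1 ht.2
  rw [show g b = g a + α * (b - a) by linarith] at this
  refine le_of_mul_le_mul_left ?_ (sub_pos.mpr hlt)
  linarith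

/-- The hypograph contains the triangle with base `[a, b]` and apex over `c`. -/
lemma ConcaveOn.triangle_le_integral {g : ℝ → ℝ} {a b c : ℝ} (hac : a ≤ c) (hcb : c ≤ b)
    (hg : ConcaveOn ℝ (Set.Icc a b) g) (hi : IntervalIntegrable g MeasureTheory.volume a b)
    (ha : 0 ≤ g a) (hb : 0 ≤ g b) : (b - a) * g c / 2 ≤ ∫ t in a..b, g t := by
  have hab := hac.trans hcb
  have i₁ : IntervalIntegrable g MeasureTheory.volume a c :=
    hi.mono_set (by rw [Set.uIcc_of_le hac, Set.uIcc_of_le hab]; exact Set.Icc_subset_Icc_right hcb)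
  have i₂ : IntervalIntegrable g MeasureTheory.volume c b :=
    hi.mono_set (by rw [Set.uIcc_of_le hcb, Set.uIcc_of_le hab]; exact Set.Icc_subset_Icc_left hac)
  have h₁ := (hg.subset (Set.Icc_subset_Icc_right hcb) (convex_Icc _ _)).trapezoid_le_integral hac i₁
  have h₂ := (hg.subset (Set.Icc_subset_Icc_left hac) (convex_Icc _ _)).trapezoid_le_integral hcb i₂
  rw [← intervalIntegral.integral_add_adjacent_intervals i₁ i₂]
  nlinarith [mul_nonneg (sub_nonneg.mpr hac) ha, mul_nonneg (sub_nonneg.mpr hcb) hb]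

/-! ### Planar lattice polygons as regions between two graphs. -/

/-- The point of the real plane given by an integer vector. -/
def realPoint (v : ℤ × ℤ) : ℝ × ℝ := (v.1, v.2)

/-- The lattice polygon spanned by a finite set of points of `ℤ²`. -/
def planarHull (V : Finset (ℤ × ℤ)) : Set (ℝ × ℝ) := convexHull ℝ (realPoint '' (V : Set (ℤ × ℤ)))

/-- The number of lattice points in the `n`-fold dilate of `planarHull V`. -/
noncomputable def planarCount (V : Finset (ℤ × ℤ)) (n : ℕ) : ℕ :=
  {z : ℤ × ℤ | realPoint z ∈ (n : ℝ) • planarHull V}.ncard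

/-- `V` contains the vertices of a nondegenerate triangle. -/
def HasTriangle (V : Finset (ℤ × ℤ)) : Prop :=
  ∃ u ∈ V, ∃ v ∈ V, ∃ w ∈ V, (v.1 - u.1) * (w.2 - u.2) - (v.2 - u.2) * (w.1 - u.1) ≠ 0

lemma HasTriangle.exists_ne_affine {V : Finset (ℤ × ℤ)} (hV : HasTriangle V) (α β : ℝ) :
    ∃ v ∈ V, (v.1 : ℝ) ≠ α * v.2 + β := by
  by_contra! h
  obtain ⟨u, hu, v, hv, w, hw, hne⟩ := hV
  apply hne
  have : ((v.1 - u.1) * (w.2 - u.2) - (v.2 - u.2) * (w.1 - u.1) : ℝ) = 0 := by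
    rw [h u hu, h v hv, h w hw]; ring
  exact_mod_cast this

/-- `planarHull V` is the region `l t ≤ x ≤ r t`, `a ≤ t ≤ b`. -/
structure RowBounds (V : Finset (ℤ × ℤ)) (a b : ℤ) (l r : ℝ → ℝ) : Prop where
  lt : a < b
  upper : IsUpperHull V a b r
  lower : IsUpperHull (V.image (fun v => (-v.1, v.2))) a b (fun t => -l t)
  mem_iff : ∀ x t, (x, t) ∈ planarHull V ↔ t ∈ Set.Icc (a : ℝ) b ∧ x ∈ Set.Icc (l t) (r t)
  le : ∀ t ∈ Set.Icc (a : ℝ) b, l t ≤ r t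

lemma realPoint_mem_planarHull {V : Finset (ℤ × ℤ)} {v : ℤ × ℤ} (hv : v ∈ V) :
    realPoint v ∈ planarHull V :=
  subset_convexHull ℝ _ ⟨v, hv, rfl⟩

lemma planarHull_subset_of_le {V : Finset (ℤ × ℤ)} {α β γ : ℝ}
    (h : ∀ v ∈ V, α * v.1 + β * v.2 ≤ γ) {x t : ℝ} (hx : (x, t) ∈ planarHull V) :
    α * x + β * t ≤ γ := by
  have hconv : Convex ℝ {p : ℝ × ℝ | α * p.1 + β * p.2 ≤ γ} := by
    apply convex_halfSpace_le
    constructor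
    · intro p q; simp; ring
    · intro c p; simp; ring
  exact convexHull_min (t := {p : ℝ × ℝ | α * p.1 + β * p.2 ≤ γ})
    (by rintro _ ⟨v, hv, rfl⟩; exact h v hv) hconv hx

lemma isCompact_planarHull (V : Finset (ℤ × ℤ)) : IsCompact (planarHull V) :=
  (V.finite_toSet.image _).isCompact_convexHull ℝ

/-- Horizontal slices are nonempty, compact and convex, hence closed intervals, with ends `l` and
`r`. Convexity of the polygon makes `r` and `-l` concave; they are least because a half-plane
containing `V` contains its hull. -/
lemma exists_rowBounds {V : Finset (ℤ × ℤ)} (hV : HasTriangle V) :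
    ∃ a b l r, RowBounds V a b l r := by
  obtain ⟨w₀, hw₀, -⟩ := id hV
  obtain ⟨u, hu, hmin⟩ := V.exists_min_image (fun v => v.2) ⟨w₀, hw₀⟩
  obtain ⟨w, hw, hmax⟩ := V.exists_max_image (fun v => v.2) ⟨w₀, hw₀⟩
  have hab : u.2 < w.2 := by
    by_contra hle
    obtain ⟨v₁, h₁, v₂, h₂, v₃, h₃, hne⟩ := hV
    have e₁ := hmin v₁ h₁; have e₂ := hmin v₂ h₂; have e₃ := hmin v₃ h₃
    have f₁ := hmax v₁ h₁; have f₂ := hmax v₂ h₂; have f₃ := hmax v₃ h₃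
    apply hne
    rw [show v₃.2 - v₁.2 = 0 by omega, show v₂.2 - v₁.2 = 0 by omega]
    ring
  have habR : (u.2 : ℝ) < w.2 := by exact_mod_cast hab
  have hconv : Convex ℝ (planarHull V) := convex_convexHull ℝ _
  have hpt : ∀ t ∈ Set.Icc (u.2 : ℝ) w.2, ∃ x : ℝ, (x, t) ∈ planarHull V := by
    intro t ht
    have h0 : (w.2 : ℝ) - u.2 ≠ 0 := by linarith
    have := hconv (realPoint_mem_planarHull hu) (realPoint_mem_planarHull hw)
      (a := (w.2 - t) / (w.2 - u.2)) (b := (t - u.2) / (w.2 - u.2))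
      (div_nonneg (by linarith [ht.2]) (by linarith))
      (div_nonneg (by linarith [ht.1]) (by linarith)) (by field_simp; ring)
    simp only [realPoint, Prod.smul_mk, smul_eq_mul, Prod.mk_add_mk] at this
    rw [show (w.2 - t) / (w.2 - u.2) * u.2 + (t - u.2) / (w.2 - u.2) * (w.2 : ℝ) = t by
      field_simp; ring] at this
    exact ⟨_, this⟩
  have hslice : ∀ t ∈ Set.Icc (u.2 : ℝ) w.2, {x : ℝ | (x, t) ∈ planarHull V}
      = Set.Icc (sInf {x : ℝ | (x, t) ∈ planarHull V}) (sSup {x : ℝ | (x, t) ∈ planarHull V}) := by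
    intro t ht
    refine eq_Icc_of_connected_compact ⟨?_, ?_⟩ ?_
    · exact hpt t ht
    · refine Convex.isPreconnected (fun x hx y hy c d hc hd hcd => ?_)
      have := hconv hx hy hc hd hcd
      simp only [Prod.smul_mk, smul_eq_mul, Prod.mk_add_mk] at this
      rw [← add_mul, hcd, one_mul] at this
      simpa using this
    · have h1 : IsCompact (planarHull V ∩ {p : ℝ × ℝ | p.2 = t}) :=
        (isCompact_planarHull V).inter_right (isClosed_eq continuous_snd continuous_const)
      convert h1.image continuous_fst using 1
      ext x
      simp only [Set.mem_ofPred_eq, Set.mem_image, Set.mem_inter_iff, Prod.exists]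
      constructor
      · exact fun h => ⟨x, t, ⟨h, rfl⟩, rfl⟩
      · rintro ⟨x', t', ⟨h, rfl⟩, rfl⟩; exact h
  obtain ⟨l, hl⟩ : ∃ l : ℝ → ℝ, l = fun t => sInf {x : ℝ | (x, t) ∈ planarHull V} := ⟨_, rfl⟩
  obtain ⟨r, hr⟩ : ∃ r : ℝ → ℝ, r = fun t => sSup {x : ℝ | (x, t) ∈ planarHull V} := ⟨_, rfl⟩
  have hmem : ∀ x t, (x, t) ∈ planarHull V ↔
      t ∈ Set.Icc (u.2 : ℝ) w.2 ∧ x ∈ Set.Icc (l t) (r t) := by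
    intro x t
    constructor
    · intro h
      have h₁ := planarHull_subset_of_le (α := 0) (β := 1) (γ := w.2)
        (fun v hv => by simpa using hmax v hv) h
      have h₂ := planarHull_subset_of_le (α := 0) (β := -1) (γ := -u.2)
        (fun v hv => by simpa using hmin v hv) h
      have ht : t ∈ Set.Icc (u.2 : ℝ) w.2 := ⟨by linarith, by linarith⟩
      refine ⟨ht, ?_⟩
      rw [hl, hr]
      simp only
      rw [← hslice t ht]
      exact h
    · rintro ⟨ht, hx⟩
      rw [hl, hr] at hx
      simp only at hx
      rw [← hslice t ht] at hx
      exact hx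
  have hle : ∀ t ∈ Set.Icc (u.2 : ℝ) w.2, l t ≤ r t := by
    intro t ht
    obtain ⟨x, hx⟩ := hpt t ht
    have := ((hmem _ _).mp hx).2
    exact this.1.trans this.2
  have hrmem : ∀ t ∈ Set.Icc (u.2 : ℝ) w.2, (r t, t) ∈ planarHull V :=
    fun t ht => (hmem _ _).mpr ⟨ht, hle t ht, le_rfl⟩
  have hlmem : ∀ t ∈ Set.Icc (u.2 : ℝ) w.2, (l t, t) ∈ planarHull V :=
    fun t ht => (hmem _ _).mpr ⟨ht, le_rfl, hle t ht⟩
  refine ⟨u.2, w.2, l, r, hab, ?_, ?_, hmem, hle⟩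
  · refine ⟨⟨convex_Icc _ _, ?_⟩, fun v hv => ⟨hmin v hv, hmax v hv⟩, ?_, ?_, ⟨u, hu, rfl⟩,
      ⟨w, hw, rfl⟩⟩
    · intro s hs t ht c d hc hd hcd
      exact ((hmem _ _).mp (hconv (hrmem s hs) (hrmem t ht) hc hd hcd)).2.2
    · exact fun v hv => ((hmem _ _).mp (realPoint_mem_planarHull hv)).2.2
    · intro α β h t ht
      have := planarHull_subset_of_le (α := 1) (β := -α) (γ := β)
        (fun v hv => by linarith [h v hv]) (hrmem t ht)
      linarith
  · refine ⟨⟨convex_Icc _ _, ?_⟩, ?_, ?_, ?_, ⟨(-u.1, u.2), ?_, rfl⟩, ⟨(-w.1, w.2), ?_, rfl⟩⟩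
    · intro s hs t ht c d hc hd hcd
      have := ((hmem _ _).mp (hconv (hlmem s hs) (hlmem t ht) hc hd hcd)).2.1
      simp only [smul_eq_mul, Prod.smul_mk] at this ⊢
      linarith
    · intro v hv
      obtain ⟨v', hv', rfl⟩ := Finset.mem_image.mp hv
      exact ⟨hmin v' hv', hmax v' hv'⟩
    · intro v hv
      obtain ⟨v', hv', rfl⟩ := Finset.mem_image.mp hv
      have := ((hmem _ _).mp (realPoint_mem_planarHull hv')).2.1
      simpa using this
    · intro α β h t ht
      have := planarHull_subset_of_le (α := -1) (β := -α) (γ := β)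
        (fun v hv => by
          have := h _ (Finset.mem_image_of_mem _ hv)
          push_cast at this
          linarith) (hlmem t ht)
      linarith
    · exact Finset.mem_image_of_mem (fun v : ℤ × ℤ => (-v.1, v.2)) hu
    · exact Finset.mem_image_of_mem (fun v : ℤ × ℤ => (-v.1, v.2)) hw

/-! ### Counting by rows: the Ehrhart polynomial and Pick's formula. -/

lemma card_le_integralRows {g : ℝ → ℝ} {a b : ℤ} (s : Finset ℤ)
    (hs : ∀ y ∈ s, a ≤ y ∧ y < b ∧ ∃ x : ℤ, g y = x) : s.card ≤ integralRows g a b := by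
  classical
  refine Finset.card_le_card fun y hy => ?_
  obtain ⟨h₁, h₂, h₃⟩ := hs y hy
  simp [h₁, h₂, h₃]

lemma integralRows_le (g : ℝ → ℝ) {a b : ℤ} (hab : a ≤ b) : (integralRows g a b : ℤ) ≤ b - a := by
  classical
  have : integralRows g a b ≤ (Finset.Ico a b).card := Finset.card_filter_le _ _
  rw [Int.card_Ico] at this
  omega

namespace IsUpperHull

variable {V : Finset (ℤ × ℤ)} {a b : ℤ} {g : ℝ → ℝ}

lemma one_le_integralRows (h : IsUpperHull V a b g) (hab : a < b) : 1 ≤ integralRows g a b := by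
  obtain ⟨x, -, hx⟩ := h.exists_int_left
  refine card_le_integralRows {a} fun y hy => ?_
  obtain rfl := Finset.mem_singleton.mp hy
  exact ⟨le_rfl, hab, x, hx⟩

lemma two_le_integralRows (h : IsUpperHull V a b g) (hab : a < b) {α β : ℝ}
    (ha : g a = α * a + β) (hb : g b = α * b + β) (hV : ∃ v ∈ V, α * v.2 + β < (v.1 : ℝ)) :
    2 ≤ integralRows g a b := by
  obtain ⟨x, -, hx⟩ := h.exists_int_left
  obtain ⟨v, -, h₁, h₂, h₃, -⟩ := h.exists_vertex_above le_rfl hab le_rfl ha hb hV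
  rw [← Finset.card_pair h₁.ne]
  refine card_le_integralRows _ fun y hy => ?_
  rcases Finset.mem_insert.mp hy with rfl | hy
  · exact ⟨le_rfl, hab, x, hx⟩
  · obtain rfl := Finset.mem_singleton.mp hy
    exact ⟨h₁.le, h₂, v.1, h₃⟩

end IsUpperHull

/-- The right side counts the integers in `[x, y]`. As `x < y`, integral endpoints are distinct and
each is counted. -/
lemma floor_add_floor_neg_lower_bound {x y : ℝ} (h : x < y) [Decidable (∃ m : ℤ, y = m)]
    [Decidable (∃ m : ℤ, -x = m)] :
    ((if ∃ m : ℤ, y = m then 1 else 0) + if ∃ m : ℤ, -x = m then 1 else 0 : ℤ)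
      ≤ ⌊y⌋ + ⌊-x⌋ + 1 := by
  have h₁ : y < ⌊y⌋ + 1 := Int.lt_floor_add_one y
  have h₂ : -x < ⌊-x⌋ + 1 := Int.lt_floor_add_one (-x)
  have h₀ : (-2 : ℝ) < ((⌊y⌋ + ⌊-x⌋ : ℤ) : ℝ) := by push_cast; linarith
  have h₀' : -2 < ⌊y⌋ + ⌊-x⌋ := by exact_mod_cast h₀
  split_ifs with hy hx hx
  · obtain ⟨m, hm⟩ := hy
    obtain ⟨k, hk⟩ := hx
    rw [hm, hk, Int.floor_intCast, Int.floor_intCast]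
    have : (0 : ℝ) < ((m + k : ℤ) : ℝ) := by push_cast; linarith
    have : 0 < m + k := by exact_mod_cast this
    omega
  · obtain ⟨m, hm⟩ := hy
    rw [hm, Int.floor_intCast]
    have : (-1 : ℝ) < ((m + ⌊-x⌋ : ℤ) : ℝ) := by push_cast; linarith
    have : -1 < m + ⌊-x⌋ := by exact_mod_cast this
    omega
  · obtain ⟨k, hk⟩ := hx
    rw [hk, Int.floor_intCast]
    have : (-1 : ℝ) < ((⌊y⌋ + k : ℤ) : ℝ) := by push_cast; linarith
    have : -1 < ⌊y⌋ + k := by exact_mod_cast this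
    omega
  · omega

lemma card_Icc_ceil_floor {x y : ℝ} (h : x ≤ y) :
    ((Finset.Icc ⌈x⌉ ⌊y⌋).card : ℤ) = ⌊y⌋ + ⌊-x⌋ + 1 := by
  have h₁ : y < ⌊y⌋ + 1 := Int.lt_floor_add_one y
  have h₂ : -x < ⌊-x⌋ + 1 := Int.lt_floor_add_one (-x)
  have h₀ : (-2 : ℝ) < ((⌊y⌋ + ⌊-x⌋ : ℤ) : ℝ) := by push_cast; linarith
  have h₀' : -2 < ⌊y⌋ + ⌊-x⌋ := by exact_mod_cast h₀
  rw [Int.card_Icc, Int.floor_neg] at *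
  omega

namespace RowBounds

variable {V : Finset (ℤ × ℤ)} {a b : ℤ} {l r : ℝ → ℝ}

lemma le_of_mem (h : RowBounds V a b l r) {v : ℤ × ℤ} (hv : v ∈ V) :
    (v.2 : ℝ) ∈ Set.Icc (a : ℝ) b ∧ l v.2 ≤ v.1 ∧ (v.1 : ℝ) ≤ r v.2 := by
  have := (h.mem_iff _ _).mp (realPoint_mem_planarHull hv)
  exact ⟨this.1, this.2.1, this.2.2⟩

lemma exists_width_left (h : RowBounds V a b l r) :
    ∃ x₀ x₁ : ℤ, l a = x₀ ∧ r a = x₁ ∧ x₀ ≤ x₁ := by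
  obtain ⟨x₁, -, h₁⟩ := h.upper.exists_int_left
  obtain ⟨x₀, -, h₀⟩ := h.lower.exists_int_left
  refine ⟨-x₀, x₁, by push_cast; linarith, h₁, ?_⟩
  have hab : (a : ℝ) ≤ b := by exact_mod_cast h.lt.le
  have := h.le a ⟨le_rfl, hab⟩
  have : ((-x₀ : ℤ) : ℝ) ≤ x₁ := by push_cast; linarith
  exact_mod_cast this

lemma exists_width_right (h : RowBounds V a b l r) :
    ∃ x₀ x₁ : ℤ, l b = x₀ ∧ r b = x₁ ∧ x₀ ≤ x₁ := by
  obtain ⟨x₁, -, h₁⟩ := h.upper.exists_int_right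
  obtain ⟨x₀, -, h₀⟩ := h.lower.exists_int_right
  refine ⟨-x₀, x₁, by push_cast; linarith, h₁, ?_⟩
  have hab : (a : ℝ) ≤ b := by exact_mod_cast h.lt.le
  have := h.le b ⟨hab, le_rfl⟩
  have : ((-x₀ : ℤ) : ℝ) ≤ x₁ := by push_cast; linarith
  exact_mod_cast this

/-- The top row is kept apart so that the other rows form the half-open range of `HasFloorSum`. -/
lemma planarCount_eq_sum (h : RowBounds V a b l r) {n : ℕ} (hn : 0 < n) :
    (planarCount V n : ℤ)
      = ∑ y ∈ Finset.Ico (n * a) (n * b), (⌊n * r (y / n)⌋ + ⌊n * -l (y / n)⌋ + 1)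
        + (⌊n * r b⌋ + ⌊n * -l b⌋ + 1) := by
  classical
  have hnR : (0 : ℝ) < n := by exact_mod_cast hn
  have hnZ : (0 : ℤ) ≤ n := by positivity
  have hset : {z : ℤ × ℤ | realPoint z ∈ (n : ℝ) • planarHull V}
      = (((Finset.Icc (n * a) (n * b)).sigma
          (fun y : ℤ => Finset.Icc ⌈n * l (y / n)⌉ ⌊n * r (y / n)⌋)).image
            (fun s : (_ : ℤ) × ℤ => (s.2, s.1)) : Finset (ℤ × ℤ)) := by
    ext ⟨x, y⟩
    rw [Set.mem_ofPred_eq, Set.mem_smul_set_iff_inv_smul_mem₀ hnR.ne']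
    have e : (n : ℝ)⁻¹ • realPoint (x, y) = ((x : ℝ) / n, (y : ℝ) / n) := by
      simp only [realPoint, Prod.smul_mk, smul_eq_mul, div_eq_inv_mul]
    rw [e, h.mem_iff]
    simp only [Finset.coe_image, Set.mem_image, Finset.mem_coe, Finset.mem_sigma, Finset.mem_Icc,
      Sigma.exists, Prod.mk.injEq, Set.mem_Icc]
    have e₁ : (a : ℝ) ≤ y / n ↔ n * a ≤ y := by
      rw [le_div_iff₀ hnR, mul_comm]; exact_mod_cast Iff.rfl
    have e₂ : (y : ℝ) / n ≤ b ↔ y ≤ n * b := by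
      rw [div_le_iff₀ hnR, mul_comm]; exact_mod_cast Iff.rfl
    rw [e₁, e₂]
    constructor
    · rintro ⟨hy, h₁, h₂⟩
      refine ⟨y, x, ⟨hy, ?_, ?_⟩, rfl, rfl⟩
      · rw [Int.ceil_le, mul_comm]; exact (le_div_iff₀ hnR).mp h₁
      · rw [Int.le_floor, mul_comm]; exact (div_le_iff₀ hnR).mp h₂
    · rintro ⟨y', x', ⟨hy, h₁, h₂⟩, rfl, rfl⟩
      refine ⟨hy, ?_, ?_⟩
      · rw [le_div_iff₀ hnR, mul_comm]; exact Int.ceil_le.mp h₁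
      · rw [div_le_iff₀ hnR, mul_comm]; exact Int.le_floor.mp h₂
  have hinj : Function.Injective (fun s : (_ : ℤ) × ℤ => (s.2, s.1)) := by
    rintro ⟨y, x⟩ ⟨y', x'⟩ hs
    simp only [Prod.mk.injEq] at hs
    obtain ⟨rfl, rfl⟩ := hs
    rfl
  rw [planarCount, hset, Set.ncard_coe_finset, Finset.card_image_of_injective _ hinj,
    Finset.card_sigma]
  push_cast
  have hrow : ∀ y ∈ Finset.Icc ((n : ℤ) * a) (n * b),
      ((Finset.Icc ⌈(n : ℝ) * l (y / n)⌉ ⌊n * r (y / n)⌋).card : ℤ)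
        = ⌊n * r (y / n)⌋ + ⌊n * -l (y / n)⌋ + 1 := by
    intro y hy
    obtain ⟨h₁, h₂⟩ := Finset.mem_Icc.mp hy
    have h₁' : (n : ℝ) * a ≤ y := by exact_mod_cast h₁
    have h₂' : (y : ℝ) ≤ n * b := by exact_mod_cast h₂
    have := h.le (y / n) ⟨by rw [le_div_iff₀ hnR]; linarith, by rw [div_le_iff₀ hnR]; linarith⟩
    rw [card_Icc_ceil_floor (mul_le_mul_of_nonneg_left this hnR.le), mul_neg]
  rw [Finset.sum_congr rfl hrow,
    ← Finset.Ico_insert_right (mul_le_mul_of_nonneg_left h.lt.le hnZ),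
    Finset.sum_insert (by simp), add_comm]
  congr 1
  have : (((n : ℤ) * b : ℤ) : ℝ) / n = b := by push_cast; field_simp
  rw [this]

lemma planarCount_zero (h : RowBounds V a b l r) : planarCount V 0 = 1 := by
  obtain ⟨v, hv, -⟩ := h.upper.exists_left
  have hne : (planarHull V).Nonempty := ⟨_, realPoint_mem_planarHull hv⟩
  have : {z : ℤ × ℤ | realPoint z ∈ ((0 : ℕ) : ℝ) • planarHull V} = {0} := by
    ext ⟨x, y⟩
    rw [Nat.cast_zero, Set.zero_smul_set hne]
    simp [realPoint, Prod.ext_iff]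
  rw [planarCount, this, Set.ncard_singleton]

/-- The number of lattice points on the boundary of the polygon. -/
noncomputable def boundaryCount (a b : ℤ) (l r : ℝ → ℝ) : ℝ :=
  (r a - l a) + (r b - l b) + integralRows r a b + integralRows (fun t => -l t) a b

/-- The area of the polygon. -/
noncomputable def area (a b : ℤ) (l r : ℝ → ℝ) : ℝ :=
  (∫ t in (a : ℝ)..b, r t) + ∫ t in (a : ℝ)..b, -l t

/-- The `+ 1` of each row cancels the terms `-n(b - a)/2` of the two floor sums; what remains in the
linear term is half the boundary count. -/
lemma planarCount_eq (h : RowBounds V a b l r) (n : ℕ) :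
    (planarCount V n : ℝ) = area a b l r * n ^ 2 + boundaryCount a b l r / 2 * n + 1 := by
  rcases Nat.eq_zero_or_pos n with rfl | hn
  · rw [h.planarCount_zero]; simp
  have hsum := h.planarCount_eq_sum hn
  obtain ⟨x₀, x₁, h₀, h₁, -⟩ := h.exists_width_right
  have hr := (h.upper.hasFloorSum h.lt).2 n
  have hl := (h.lower.hasFloorSum h.lt).2 n
  have hsum' : (planarCount V n : ℝ)
      = ∑ y ∈ Finset.Ico (n * a) (n * b), ((⌊n * r (y / n)⌋ : ℝ) + ⌊n * -l (y / n)⌋ + 1)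
        + ((⌊n * r b⌋ : ℝ) + ⌊n * -l b⌋ + 1) := by
    exact_mod_cast hsum
  have e₁ : (⌊(n : ℝ) * r b⌋ : ℝ) = n * r b := by
    rw [h₁, show (n : ℝ) * x₁ = ((n * x₁ : ℤ) : ℝ) by push_cast; ring, Int.floor_intCast]
  have e₂ : (⌊(n : ℝ) * -l b⌋ : ℝ) = n * -l b := by
    rw [h₀, show (n : ℝ) * -x₀ = ((n * -x₀ : ℤ) : ℝ) by push_cast; ring, Int.floor_intCast]
  have hcard : (((n : ℤ) * b - n * a).toNat : ℝ) = n * b - n * a := by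
    have : (n : ℤ) * a ≤ n * b := mul_le_mul_of_nonneg_left h.lt.le (by positivity)
    have h' : (((n : ℤ) * b - n * a).toNat : ℤ) = n * b - n * a := by omega
    exact_mod_cast h'
  rw [hsum', Finset.sum_add_distrib, Finset.sum_add_distrib, hr, hl, e₁, e₂, Finset.sum_const,
    Int.card_Ico, nsmul_eq_mul, hcard, area, boundaryCount]
  ring

/-- If `l = r` throughout, this function is both concave and convex, hence affine, and `V` would be
collinear. -/
lemma exists_lt (h : RowBounds V a b l r) (hV : HasTriangle V) :
    ∃ t ∈ Set.Icc (a : ℝ) b, l t < r t := by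
  by_contra! hc
  have hab : (a : ℝ) < b := by exact_mod_cast h.lt
  have ha : (a : ℝ) ∈ Set.Icc (a : ℝ) b := ⟨le_rfl, hab.le⟩
  have hb : (b : ℝ) ∈ Set.Icc (a : ℝ) b := ⟨hab.le, le_rfl⟩
  have h0 : (b : ℝ) - a ≠ 0 := by linarith
  obtain ⟨α, hα⟩ : ∃ α : ℝ, α = (r b - r a) / (b - a) := ⟨_, rfl⟩
  have hα' : α * (b - a) = r b - r a := by rw [hα]; field_simp
  obtain ⟨v, hv, hne⟩ := hV.exists_ne_affine α (r a - α * a)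
  apply hne
  obtain ⟨hvI, hl, hr⟩ := h.le_of_mem hv
  have e : ∀ t ∈ Set.Icc (a : ℝ) b, l t = r t := fun t ht => le_antisymm (h.le t ht) (hc t ht)
  have h₁ := h.upper.concave.three_point ha hb hvI.1 hvI.2
  have h₂ := h.lower.concave.three_point ha hb hvI.1 hvI.2
  simp only [e _ ha, e _ hb, e _ hvI] at h₂
  have hx : (v.1 : ℝ) = r v.2 := le_antisymm hr (by rw [← e _ hvI]; exact hl)
  rw [hx]
  refine mul_left_cancel₀ h0 ?_
  rw [show r b = r a + α * (b - a) by linarith] at h₁ h₂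
  linarith

lemma lt_of_mem_Ioo (h : RowBounds V a b l r) (hV : HasTriangle V) {t : ℝ}
    (ht : t ∈ Set.Ioo (a : ℝ) b) : l t < r t := by
  obtain ⟨s, hs, hlt⟩ := h.exists_lt hV
  have hab : (a : ℝ) < b := by exact_mod_cast h.lt
  have ha : (a : ℝ) ∈ Set.Icc (a : ℝ) b := ⟨le_rfl, hab.le⟩
  have hb : (b : ℝ) ∈ Set.Icc (a : ℝ) b := ⟨hab.le, le_rfl⟩
  have hla := h.le _ ha
  have hlb := h.le _ hb
  rcases le_total s t with hst | hst
  · have h₁ := h.upper.concave.three_point hs hb hst ht.2.le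
    have h₂ := h.lower.concave.three_point hs hb hst ht.2.le
    have h₃ : 0 < (b - t) * (r s - l s) := mul_pos (by linarith [ht.2]) (by linarith)
    have h₄ : 0 ≤ (t - s) * (r b - l b) := mul_nonneg (by linarith) (by linarith)
    have h₅ : 0 < (b - s) * (r t - l t) := by linarith
    have := (mul_pos_iff_of_pos_left (by linarith [ht.2] : 0 < (b : ℝ) - s)).mp h₅
    linarith
  · have h₁ := h.upper.concave.three_point ha hs ht.1.le hst
    have h₂ := h.lower.concave.three_point ha hs ht.1.le hst
    have h₃ : 0 < (t - a) * (r s - l s) := mul_pos (by linarith [ht.1]) (by linarith)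
    have h₄ : 0 ≤ (s - t) * (r a - l a) := mul_nonneg (by linarith) (by linarith)
    have h₅ : 0 < (s - a) * (r t - l t) := by linarith
    have := (mul_pos_iff_of_pos_left (by linarith [ht.1] : 0 < s - (a : ℝ))).mp h₅
    linarith

/-- Each of the two chains contributes its lower end. A third point comes from a nondegenerate
horizontal edge or, if there is none, from a vertex off the line joining the bottom and top
vertices. -/
lemma three_le_boundaryCount (h : RowBounds V a b l r) (hV : HasTriangle V) :
    3 ≤ boundaryCount a b l r := by
  obtain ⟨x₀, x₁, h₀, h₁, hx⟩ := h.exists_width_left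
  obtain ⟨y₀, y₁, k₀, k₁, hy⟩ := h.exists_width_right
  have hBr := h.upper.one_le_integralRows h.lt
  have hBl := h.lower.one_le_integralRows h.lt
  suffices hs : 3 ≤ (x₁ - x₀) + (y₁ - y₀) + (integralRows r a b : ℤ)
      + integralRows (fun t => -l t) a b by
    rw [boundaryCount, h₀, h₁, k₀, k₁]
    exact_mod_cast hs
  by_cases hq : x₀ = x₁ ∧ y₀ = y₁
  · obtain ⟨rfl, rfl⟩ := hq
    have hab : (a : ℝ) < b := by exact_mod_cast h.lt
    have h0 : (b : ℝ) - a ≠ 0 := by linarith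
    obtain ⟨α, hα⟩ : ∃ α : ℝ, α = (y₀ - x₀) / (b - a) := ⟨_, rfl⟩
    have hα' : α * (b - a) = y₀ - x₀ := by rw [hα]; field_simp
    obtain ⟨v, hv, hne⟩ := hV.exists_ne_affine α (x₀ - α * a)
    rcases hne.lt_or_gt with hlt | hlt
    · have := h.lower.two_le_integralRows h.lt (α := -α) (β := -(x₀ - α * a))
        (by rw [h₀]; ring) (by rw [k₀]; linarith)
        ⟨(-v.1, v.2), Finset.mem_image_of_mem (fun v : ℤ × ℤ => (-v.1, v.2)) hv, by
          push_cast; linarith⟩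
      omega
    · have := h.upper.two_le_integralRows h.lt (α := α) (β := x₀ - α * a)
        (by rw [h₁]; ring) (by rw [k₁]; linarith) ⟨v, hv, hlt⟩
      omega
  · omega

lemma boundaryCount_le_planarCount_one (h : RowBounds V a b l r) (hV : HasTriangle V) :
    boundaryCount a b l r ≤ planarCount V 1 := by
  classical
  obtain ⟨x₀, x₁, h₀, h₁, hx⟩ := h.exists_width_left
  obtain ⟨y₀, y₁, k₀, k₁, hy⟩ := h.exists_width_right
  have hsum := h.planarCount_eq_sum one_pos
  simp only [Nat.cast_one, one_mul, div_one] at hsum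
  rw [k₀, k₁, Int.floor_intCast, ← Int.cast_neg, Int.floor_intCast] at hsum
  -- The bottom row has `x₁ - x₀ + 1` points, of which the two indicators account for `2`. The
  -- correction is `-1` if the row is a single point; the extra `1` of the top row makes up for it.
  have hrow : ∀ y ∈ Finset.Ico a b,
      ((if ∃ x : ℤ, r y = x then 1 else 0) + (if ∃ x : ℤ, -l y = x then 1 else 0)
        + (if y = a then x₁ - x₀ - 1 else 0) : ℤ) ≤ ⌊r y⌋ + ⌊-l y⌋ + 1 := by
    intro y hy
    obtain ⟨hya, hyb⟩ := Finset.mem_Ico.mp hy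
    rcases hya.eq_or_lt with rfl | hlt
    · rw [if_pos ⟨x₁, h₁⟩, if_pos ⟨-x₀, by rw [h₀]; push_cast; ring⟩, if_pos rfl, h₀, h₁,
        Int.floor_intCast, ← Int.cast_neg, Int.floor_intCast]
      omega
    · rw [if_neg hlt.ne', add_zero]
      exact floor_add_floor_neg_lower_bound
        (h.lt_of_mem_Ioo hV ⟨by exact_mod_cast hlt, by exact_mod_cast hyb⟩)
  have hle := Finset.sum_le_sum hrow
  rw [Finset.sum_add_distrib, Finset.sum_add_distrib,
    Finset.sum_ite_eq' (Finset.Ico a b) a (fun _ => x₁ - x₀ - 1),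
    if_pos (Finset.left_mem_Ico.mpr h.lt)] at hle
  have er : (integralRows r a b : ℤ)
      = ∑ y ∈ Finset.Ico a b, if ∃ x : ℤ, r y = x then 1 else 0 := by
    rw [integralRows, Finset.card_filter]; push_cast; rfl
  have el : (integralRows (fun t => -l t) a b : ℤ)
      = ∑ y ∈ Finset.Ico a b, if ∃ x : ℤ, -l y = x then 1 else 0 := by
    rw [integralRows, Finset.card_filter]; push_cast; rfl
  rw [← er, ← el] at hle
  have : (x₁ - x₀) + (y₁ - y₀) + (integralRows r a b : ℤ)
      + integralRows (fun t => -l t) a b ≤ planarCount V 1 := by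
    rw [hsum]; linarith
  rw [boundaryCount, h₀, h₁, k₀, k₁]
  exact_mod_cast this

/-- The lattice point counts of a lattice polygon in terms of the numbers `k` and `i` of boundary
points and interior points, with Pick's formula for the area. -/
lemma exists_counts (h : RowBounds V a b l r) (hV : HasTriangle V) :
    ∃ k i q : ℕ, boundaryCount a b l r = k ∧ (q : ℝ) = (r a - l a) + (r b - l b) ∧ 3 ≤ k ∧
      (k : ℤ) ≤ q + 2 * (b - a) ∧ area a b l r = i + k / 2 - 1 ∧ (b = a + 1 → i = 0) := by
  obtain ⟨x₀, x₁, h₀, h₁, hx⟩ := h.exists_width_left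
  obtain ⟨y₀, y₁, k₀, k₁, hy⟩ := h.exists_width_right
  obtain ⟨q, hq⟩ : ∃ q : ℕ, (q : ℤ) = (x₁ - x₀) + (y₁ - y₀) :=
    ⟨((x₁ - x₀) + (y₁ - y₀)).toNat, by omega⟩
  have hqR : (q : ℝ) = (r a - l a) + (r b - l b) := by
    rw [h₀, h₁, k₀, k₁]; exact_mod_cast hq
  obtain ⟨k, hk⟩ : ∃ k : ℕ, k = q + integralRows r a b + integralRows (fun t => -l t) a b :=
    ⟨_, rfl⟩
  have hkR : boundaryCount a b l r = k := by
    rw [boundaryCount, ← hqR, hk]; push_cast; ring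
  have h3 := h.three_le_boundaryCount hV
  have hc := h.boundaryCount_le_planarCount_one hV
  rw [hkR] at h3 hc
  have hc' : k ≤ planarCount V 1 := by exact_mod_cast hc
  have hcount := h.planarCount_eq 1
  rw [hkR] at hcount
  refine ⟨k, planarCount V 1 - k, q, hkR, hqR, by exact_mod_cast h3, ?_, ?_, ?_⟩
  · have hr := integralRows_le r h.lt.le
    have hl := integralRows_le (fun t => -l t) h.lt.le
    rw [hk]; push_cast; linarith
  · rw [Nat.cast_sub hc', hcount]; push_cast; ring
  -- At height one all lattice points lie in the bottom and top rows, hence on the boundary.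
  · rintro rfl
    have hr := h.upper.one_le_integralRows h.lt
    have hl := h.lower.one_le_integralRows h.lt
    have hsum := h.planarCount_eq_sum one_pos
    simp only [Nat.cast_one, one_mul, div_one] at hsum
    rw [k₀, k₁, Int.floor_intCast, ← Int.cast_neg, Int.floor_intCast] at hsum
    have hI : Finset.Ico a (a + 1) = {a} := by ext y; simp; omega
    rw [hI, Finset.sum_singleton, h₀, h₁, Int.floor_intCast, ← Int.cast_neg,
      Int.floor_intCast] at hsum
    omega

end RowBounds

/-! ### Unimodular maps and Scott's inequality. -/

lemma planarCount_image {e : ℤ × ℤ ≃ ℤ × ℤ} {T : ℝ × ℝ →ₗ[ℝ] ℝ × ℝ} (hT : Function.Injective T)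
    (hTe : ∀ z, T (realPoint z) = realPoint (e z)) (V : Finset (ℤ × ℤ)) (n : ℕ) :
    planarCount (V.image e) n = planarCount V n := by
  have hhull : planarHull (V.image e) = T '' planarHull V := by
    rw [planarHull, planarHull, T.image_convexHull, Finset.coe_image, Set.image_image,
      Set.image_image]
    simp only [hTe]
  have hset : {z : ℤ × ℤ | realPoint z ∈ (n : ℝ) • planarHull (V.image e)}
      = e '' {z : ℤ × ℤ | realPoint z ∈ (n : ℝ) • planarHull V} := by
    ext z
    obtain ⟨z, rfl⟩ := e.surjective z
    rw [hhull, ← image_smul_set]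
    simp only [Set.mem_ofPred_eq, ← hTe, e.injective.mem_set_image, hT.mem_set_image]
  rw [planarCount, hset, Set.ncard_image_of_injective _ e.injective, planarCount]

/-- The unimodular map `(x, y) ↦ (y, x + k y)`. -/
def shearSwap (k : ℤ) : ℤ × ℤ ≃ ℤ × ℤ where
  toFun v := (v.2, v.1 + k * v.2)
  invFun v := (v.2 - k * v.1, v.1)
  left_inv v := by ext <;> simp
  right_inv v := by ext <;> simp

lemma planarCount_image_shearSwap (k : ℤ) (V : Finset (ℤ × ℤ)) (n : ℕ) :
    planarCount (V.image (shearSwap k)) n = planarCount V n := by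
  refine planarCount_image (T := (LinearMap.snd ℝ ℝ ℝ).prod
    (LinearMap.fst ℝ ℝ ℝ + (k : ℝ) • LinearMap.snd ℝ ℝ ℝ)) ?_ ?_ V n
  · rintro ⟨x, y⟩ ⟨x', y'⟩ h
    simp at h
    obtain ⟨rfl, h⟩ := h
    ext <;> simp_all
  · intro z
    simp [realPoint, shearSwap]

lemma HasTriangle.image_shearSwap {V : Finset (ℤ × ℤ)} (hV : HasTriangle V) (k : ℤ) :
    HasTriangle (V.image (shearSwap k)) := by
  obtain ⟨u, hu, v, hv, w, hw, hne⟩ := hV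
  refine ⟨_, Finset.mem_image_of_mem _ hu, _, Finset.mem_image_of_mem _ hv, _,
    Finset.mem_image_of_mem _ hw, fun h => hne ?_⟩
  simp only [shearSwap, Equiv.coe_fn_mk] at h
  linarith

/-- A multiple of `p` moves the midpoint of `[L, R]` to within `p / 2` of `0`; the point of the
moved interval nearest to `0` is then within `(p - s) / 2`. -/
lemma exists_shear_offset {p s L R : ℝ} (hp : 0 < p) (hLR : R - L = s) (hs0 : 0 ≤ s)
    (hsp : s ≤ p) : ∃ k : ℤ, ∃ D ∈ Set.Icc L R, |D + k * p| ≤ (p - s) / 2 := by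
  obtain ⟨c, hc⟩ : ∃ c, c = (L + R) / 2 := ⟨_, rfl⟩
  obtain ⟨k, hk⟩ : ∃ k : ℤ, k = -round (c / p) := ⟨_, rfl⟩
  have hround : |c + k * p| ≤ p / 2 := by
    have h := abs_sub_round (c / p)
    have e : c + k * p = (c / p - round (c / p)) * p := by
      rw [hk]; push_cast; field_simp; ring
    rw [e, abs_mul, abs_of_pos hp]
    nlinarith
  obtain ⟨h₁, h₂⟩ := abs_le.mp hround
  refine ⟨k, ?_⟩
  rcases lt_or_ge (s / 2) (c + k * p) with h | h
  · exact ⟨L, ⟨le_rfl, by linarith⟩, abs_le.mpr ⟨by linarith, by linarith⟩⟩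
  rcases lt_or_ge (c + k * p) (-(s / 2)) with h' | h'
  · exact ⟨R, ⟨by linarith, le_rfl⟩, abs_le.mpr ⟨by linarith, by linarith⟩⟩
  · exact ⟨-(k * p), ⟨by linarith, by linarith⟩, by
      rw [neg_add_cancel, abs_zero]; linarith⟩

namespace RowBounds

variable {V : Finset (ℤ × ℤ)} {a b : ℤ} {l r : ℝ → ℝ}

lemma trapezoid_le_area (h : RowBounds V a b l r) :
    (b - a) * ((r a - l a) + (r b - l b)) / 2 ≤ area a b l r := by
  have hab : (a : ℝ) ≤ b := by exact_mod_cast h.lt.le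
  have h₁ := h.upper.concave.trapezoid_le_integral hab (h.upper.hasFloorSum h.lt).1
  have h₂ := h.lower.concave.trapezoid_le_integral hab (h.lower.hasFloorSum h.lt).1
  rw [area]
  linarith

/-- A polygon containing two points whose abscissae, measured along the slope `μ` of a transversal,
differ by `W` has area at least `(b - a) W / 2`. -/
lemma transversal_le_area (h : RowBounds V a b l r) {m μ : ℝ} (hla : l a ≤ m) (hra : m ≤ r a)
    (hlb : l b ≤ m + μ * (b - a)) (hrb : m + μ * (b - a) ≤ r b) {u w : ℤ × ℤ} (hu : u ∈ V)
    (hw : w ∈ V) : (b - a) * (w.1 - u.1 - μ * (w.2 - u.2)) / 2 ≤ area a b l r := by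
  have hab : (a : ℝ) ≤ b := by exact_mod_cast h.lt.le
  obtain ⟨huI, hu₁, -⟩ := h.le_of_mem hu
  obtain ⟨hwI, -, hw₂⟩ := h.le_of_mem hw
  have iR := (h.upper.hasFloorSum h.lt).1
  have iL := (h.lower.hasFloorSum h.lt).1
  have hcont : Continuous fun t : ℝ => m + μ * (t - a) := by fun_prop
  have iM := hcont.intervalIntegrable (μ := MeasureTheory.volume) (a : ℝ) b
  have haff : ∀ c d : ℝ, ConcaveOn ℝ (Set.Icc (a : ℝ) b) (fun t => c * t + d) := by
    refine fun c d => ⟨convex_Icc _ _, fun x _ y _ p q _ _ hpq => le_of_eq ?_⟩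
    simp only [smul_eq_mul]
    linear_combination d * hpq
  have cR : ConcaveOn ℝ (Set.Icc (a : ℝ) b) (fun t => r t - (m + μ * (t - a))) := by
    refine (h.upper.concave.add (haff (-μ) (μ * a - m))).congr fun t _ => ?_
    simp only [Pi.add_apply]; ring
  have cL : ConcaveOn ℝ (Set.Icc (a : ℝ) b) (fun t => -l t + (m + μ * (t - a))) := by
    refine (h.lower.concave.add (haff μ (m - μ * a))).congr fun t _ => ?_
    simp only [Pi.add_apply]; ring
  -- On each side of the transversal the polygon contains a triangle with the transversal as base,
  -- with apex in the row of `w` or of `u`.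
  have h₁ := cR.triangle_le_integral hwI.1 hwI.2 (iR.sub iM) (by linarith)
    (by linarith)
  have h₂ := cL.triangle_le_integral huI.1 huI.2 (iL.add iM) (by linarith)
    (by linarith)
  rw [intervalIntegral.integral_sub iR iM] at h₁
  rw [intervalIntegral.integral_add iL iM] at h₂
  rw [area]
  have h₃ : (b - a) * (w.1 - u.1 - μ * (w.2 - u.2))
      ≤ (b - a) * (r w.2 - (m + μ * (w.2 - a)) + (-l u.2 + (m + μ * (u.2 - a)))) :=
    mul_le_mul_of_nonneg_left (by linarith) (by linarith)
  linarith

/-- Area bound for a polygon whose lattice width is at least the height `b - a`. -/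
lemma height_mul_le_area (h : RowBounds V a b l r) {s : ℝ}
    (hs : s = (r a - l a) + (r b - l b)) (hsp : s ≤ b - a)
    (hwidth : ∀ k : ℤ, ∃ u ∈ V, ∃ w ∈ V, b - a ≤ (w.1 + k * w.2) - (u.1 + k * u.2)) :
    (b - a) * (b - a + s) / 4 ≤ area a b l r := by
  have hab : (a : ℝ) < b := by exact_mod_cast h.lt
  have hp : (0 : ℝ) < b - a := by linarith
  have hla := h.le a ⟨le_rfl, hab.le⟩
  have hlb := h.le b ⟨hab.le, le_rfl⟩
  -- `[l b - r a, r b - l a]` is the range of horizontal displacements from the bottom edge to the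
  -- top edge, of length `s`. The shear by `k` makes the transversal of displacement `D` nearly
  -- vertical, costing at most `(p - s) / 2` of the width `p = b - a`.
  obtain ⟨k, D, ⟨hD₁, hD₂⟩, hD⟩ := exists_shear_offset (p := b - a) (s := s) (L := l b - r a)
    (R := r b - l a) hp (by linarith) (by linarith) hsp
  obtain ⟨u, hu, w, hw, huw⟩ := hwidth k
  obtain ⟨μ, hμ⟩ : ∃ μ : ℝ, μ = D / (b - a) := ⟨_, rfl⟩
  have hμ' : μ * (b - a) = D := by rw [hμ]; field_simp
  have key := h.transversal_le_area (m := max (l a) (l b - D)) (μ := μ) (le_max_left _ _)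
    (max_le hla (by linarith)) (by rw [hμ']; linarith [le_max_right (l a) (l b - D)])
    (by rw [hμ', ← le_sub_iff_add_le]; exact max_le (by linarith) (by linarith)) hu hw
  obtain ⟨huI, -⟩ := h.le_of_mem hu
  obtain ⟨hwI, -⟩ := h.le_of_mem hw
  have huw' : (b - a : ℝ) ≤ (w.1 + k * w.2) - (u.1 + k * u.2) := by exact_mod_cast huw
  have hdy : |(w.2 - u.2 : ℝ)| ≤ b - a :=
    abs_le.mpr ⟨by linarith [huI.2, hwI.1], by linarith [huI.1, hwI.2]⟩
  have hbound : (μ + k) * (w.2 - u.2) ≤ (b - a - s) / 2 := by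
    calc (μ + k) * (w.2 - u.2) ≤ |(μ + k) * (w.2 - u.2)| := le_abs_self _
      _ = |μ + k| * |(w.2 - u.2 : ℝ)| := abs_mul _ _
      _ ≤ |μ + k| * (b - a) := mul_le_mul_of_nonneg_left hdy (abs_nonneg _)
      _ = |D + k * (b - a)| := by
        rw [← hμ', ← add_mul, abs_mul, abs_of_pos hp]
      _ ≤ _ := hD
  have : (b - a) * ((b - a + s) / 2) ≤ (b - a) * (w.1 - u.1 - μ * (w.2 - u.2)) :=
    mul_le_mul_of_nonneg_left (by linarith) hp.le
  linarith

end RowBounds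

/-- Scott's inequality in terms of the height `p`, the total length `q` of the horizontal edges,
the area `A`, and the numbers `k`, `i` of boundary and interior points. -/
lemma boundary_le_of_height {A : ℝ} {k i q p : ℕ} (hA : A = i + k / 2 - 1)
    (hk : k ≤ q + 2 * p) (hi : 1 ≤ i) (hp : 2 ≤ p) (hA₁ : (p : ℝ) * q / 2 ≤ A)
    (hA₂ : q ≤ p → (p : ℝ) * (p + q) / 4 ≤ A) : k ≤ 2 * i + 6 ∨ (k = 9 ∧ i = 1) := by
  have h₁ : (p : ℤ) * q + 2 ≤ 2 * i + k := by
    have : (p : ℝ) * q + 2 ≤ 2 * i + k := by linarith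
    exact_mod_cast this
  -- Here `pq + 2 ≤ 2i + k` and `k ≤ q + 2p` suffice because `(p - 2)(q - 4) ≥ 0`.
  by_cases hcase : p = 2 ∨ 4 ≤ q
  · left
    zify at hk hp ⊢
    rcases hcase with rfl | hq
    · push_cast at *; linarith
    · zify at hq; nlinarith
  push Not at hcase
  obtain ⟨hp2, hq⟩ := hcase
  -- Now `q ≤ 3`, so `k ≤ 9`, and `k > 2i + 6` leaves only `(k, i) = (9, 1)`.
  by_cases hp3 : p = 3
  · omega
  have hp4 : 4 ≤ p := by omega
  have h₂ := hA₂ (by omega)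
  have h₃ : (p : ℤ) * (p + q) + 4 ≤ 4 * i + 2 * k := by
    have : (p : ℝ) * (p + q) + 4 ≤ 4 * i + 2 * k := by linarith
    exact_mod_cast this
  left
  zify at hk hp4 ⊢
  -- The claim amounts to `(p - 4)² + (p - 4) q ≥ 0`.
  nlinarith [sq_nonneg ((p : ℤ) - 4), mul_nonneg (sub_nonneg.mpr hp4) (Nat.cast_nonneg (α := ℤ) q)]

/-- The lattice point counts of a lattice polygon, with Scott's inequality between the numbers `k`
and `i` of boundary and interior points. -/
theorem exists_planarCount_eq {V : Finset (ℤ × ℤ)} (hV : HasTriangle V) :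
    ∃ k i : ℕ, 3 ≤ k ∧ (1 ≤ i → k ≤ 2 * i + 6 ∨ (k = 9 ∧ i = 1)) ∧
      ∀ n : ℕ, (planarCount V n : ℝ) = ((i : ℝ) + k / 2 - 1) * n ^ 2 + k / 2 * n + 1 := by
  classical
  have hex : ∃ p : ℕ, ∃ W : Finset (ℤ × ℤ), HasTriangle W ∧
      (∀ n, planarCount W n = planarCount V n) ∧ ∀ u ∈ W, ∀ w ∈ W, w.2 - u.2 ≤ (p : ℤ) := by
    obtain ⟨a, b, l, r, h⟩ := exists_rowBounds hV
    refine ⟨(b - a).toNat, V, hV, fun _ => rfl, fun u hu w hw => ?_⟩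
    have h₁ := h.upper.mem u hu
    have h₂ := h.upper.mem w hw
    omega
  obtain ⟨W, hW, hcount, hheight⟩ := Nat.find_spec hex
  have hmin := fun m => Nat.find_min hex (m := m)
  obtain ⟨p, hp⟩ : ∃ p, p = Nat.find hex := ⟨_, rfl⟩
  rw [← hp] at hheight hmin
  obtain ⟨a, b, l, r, h⟩ := exists_rowBounds hW
  obtain ⟨k, i, q, hk, hq, hk3, hkq, hA, hi⟩ := h.exists_counts hW
  have hab := h.lt
  have hbap : b - a ≤ p := by
    obtain ⟨u, hu, rfl⟩ := h.upper.exists_left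
    obtain ⟨w, hw, rfl⟩ := h.upper.exists_right
    exact hheight u hu w hw
  -- `shearSwap c` turns the functional `x + c y` into the height, so a smaller width would
  -- contradict the minimality of `p`.
  have hwidth : ∀ c : ℤ, ∃ u ∈ W, ∃ w ∈ W, b - a ≤ (w.1 + c * w.2) - (u.1 + c * u.2) := by
    intro c
    by_contra! hlt
    refine hmin (p - 1) (by omega) ⟨W.image (shearSwap c), hW.image_shearSwap c, fun n => ?_, ?_⟩
    · rw [planarCount_image_shearSwap, hcount]
    · intro u hu w hw
      obtain ⟨u', hu', rfl⟩ := Finset.mem_image.mp hu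
      obtain ⟨w', hw', rfl⟩ := Finset.mem_image.mp hw
      have := hlt u' hu' w' hw'
      simp only [shearSwap, Equiv.coe_fn_mk]
      omega
  refine ⟨k, i, hk3, fun hi1 => ?_, fun n => ?_⟩
  · obtain ⟨m, hm⟩ : ∃ m : ℕ, (m : ℤ) = b - a := ⟨(b - a).toNat, by omega⟩
    have hmR : (m : ℝ) = b - a := by exact_mod_cast hm
    refine boundary_le_of_height (p := m) (q := q) hA (by omega) hi1 ?_ ?_ ?_
    · by_contra hm2
      have := hi (by omega)
      omega
    · rw [hmR, hq]; exact h.trapezoid_le_area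
    · intro hqm
      rw [hmR]
      exact h.height_mul_le_area hq (by rw [← hmR]; exact_mod_cast hqm) hwidth
  · rw [← hcount, h.planarCount_eq, hk, hA]

/-! ### Location of the roots. -/

lemma mem_rootRegion_of_quadratic {i k : ℕ} (hk : 3 ≤ k)
    (hi : 1 ≤ i → k ≤ 2 * i + 6 ∨ (k = 9 ∧ i = 1)) {A : ℝ} (hA : A = i + k / 2 - 1) {z : ℂ}
    (hz : (A : ℂ) * z ^ 2 + (k / 2 : ℝ) * z + 1 = 0) :
    z ∈ ({-2, -1, -2 / 3} : Set ℂ) ∪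
      {w : ℂ | -1 / 2 ≤ w.re ∧ w.re < 0 ∧ |w.im| ≤ Real.sqrt 15 / 6} := by
  obtain ⟨x, y⟩ := z
  have hre : A * (x ^ 2 - y ^ 2) + k / 2 * x + 1 = 0 := by
    have := congrArg Complex.re hz
    simp [pow_two] at this
    linarith
  have him : y * (2 * A * x + k / 2) = 0 := by
    have := congrArg Complex.im hz
    simp [pow_two] at this
    linarith
  have hkR : (3 : ℝ) ≤ k := by exact_mod_cast hk
  have hreal : ∀ c : ℝ, x = c → y = 0 → (⟨x, y⟩ : ℂ) = (c : ℂ) := by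
    rintro c rfl rfl; rfl
  have hregion : -1 / 2 ≤ x → x < 0 → y = 0 → (⟨x, y⟩ : ℂ) ∈ ({-2, -1, -2 / 3} : Set ℂ) ∪
      {w : ℂ | -1 / 2 ≤ w.re ∧ w.re < 0 ∧ |w.im| ≤ Real.sqrt 15 / 6} := by
    rintro h₁ h₂ rfl
    right
    exact ⟨h₁, h₂, by simp only [abs_zero]; positivity⟩
  rcases Nat.eq_zero_or_pos i with rfl | hipos
  · have hA' : A = k / 2 - 1 := by rw [hA]; simp
    have hy : y = 0 := by
      by_contra hy
      have h0 : 2 * A * x + k / 2 = 0 := (mul_eq_zero.mp him).resolve_left hy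
      have hApos : 0 < A := by rw [hA']; linarith
      have h1 : (2 * A) ^ 2 * y ^ 2 = 4 * A - (k / 2) ^ 2 := by
        have : 2 * A * x = -(k / 2) := by linarith
        have h3 : A * x * (2 * A * x) = A * x * (-(k / 2)) := by rw [this]
        nlinarith
      have h4 : 0 < (2 * A) ^ 2 * y ^ 2 := by positivity
      rw [h1, hA'] at h4
      nlinarith [sq_nonneg ((k : ℝ) - 4)]
    subst hy
    -- The roots are `-1` and `-2 / (k - 2)`; the latter is at least `-1/2` once `k ≥ 6`.
    have hf : (x + 1) * ((k / 2 - 1) * x + 1) = 0 := by rw [hA'] at hre; linarith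
    rcases mul_eq_zero.mp hf with h | h
    · left
      rw [hreal (-1) (by linarith) rfl]
      simp
    · rcases Nat.lt_or_ge k 6 with h6 | h6
      · left
        interval_cases k
        · rw [hreal (-2) (by norm_num at h; linarith) rfl]; simp
        · rw [hreal (-1) (by norm_num at h; linarith) rfl]; simp
        · rw [hreal (-2 / 3) (by norm_num at h; linarith) rfl]; simp
      · have h6' : (6 : ℝ) ≤ k := by exact_mod_cast h6
        refine hregion ?_ ?_ rfl
        · by_contra hx; push Not at hx; nlinarith
        · by_contra hx; push Not at hx; nlinarith
  · have hiR : (1 : ℝ) ≤ i := by exact_mod_cast hipos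
    have hApos : 3 / 2 ≤ A := by rw [hA]; linarith
    by_cases hy : y = 0
    · subst hy
      have hx0 : x < 0 := by
        by_contra hx; push Not at hx
        have : 0 ≤ A * x ^ 2 := by positivity
        have : 0 ≤ (k : ℝ) / 2 * x := by positivity
        linarith
      rcases hi hipos with h | ⟨rfl, rfl⟩
      · have hR : (k : ℝ) ≤ 2 * i + 6 := by exact_mod_cast h
        refine hregion ?_ hx0 rfl
        by_contra hx; push Not at hx
        -- Expansion about `-1/2`: the constant `A/4 - k/4 + 1` is `(2i + 6 - k)/8`, and the product
        -- is positive for `x < -1/2` because `A ≥ k/2`.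
        have e : A * (x ^ 2 - 0 ^ 2) + k / 2 * x + 1
          = (A / 4 - k / 4 + 1) + (-1 / 2 - x) * (A * (1 / 2 - x) - k / 2) := by ring
        have h1 : 0 < (-1 / 2 - x) * (A * (1 / 2 - x) - k / 2) := by
          apply mul_pos (by linarith)
          have : A * 1 < A * (1 / 2 - x) := mul_lt_mul_of_pos_left (by linarith) (by linarith)
          linarith
        have h2 : 0 ≤ A / 4 - k / 4 + 1 := by rw [hA]; linarith
        linarith
      · have hA' : A = 9 / 2 := by rw [hA]; norm_num
        have hf : (x + 2 / 3) * (x + 1 / 3) = 0 := by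
          rw [hA'] at hre; push_cast at hre; linarith
        rcases mul_eq_zero.mp hf with h | h
        · left
          rw [hreal (-2 / 3) (by linarith) rfl]
          simp
        · exact hregion (by linarith) (by linarith) rfl
    · right
      have h0 : 2 * A * x + k / 2 = 0 := (mul_eq_zero.mp him).resolve_left hy
      refine ⟨?_, ?_, ?_⟩
      · simp only
        by_contra hx; push Not at hx
        nlinarith
      · simp only
        by_contra hx; push Not at hx
        nlinarith
      · simp only
        apply abs_le_of_sq_le_sq _ (by positivity)
        rw [div_pow, Real.sq_sqrt (by norm_num)]
        have this : 2 * A * x = -(k / 2) := by linarith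
        have h1 : (2 * A) ^ 2 * y ^ 2 = 4 * A - (k / 2) ^ 2 := by
          have h3 : A * x * (2 * A * x) = A * x * (-(k / 2)) := by rw [this]
          nlinarith
        -- The extremal case is `k = 3`, `A = 3/2`, where equality holds.
        have h4 : (2 * A) ^ 2 * y ^ 2 ≤ (2 * A) ^ 2 * (15 / 6 ^ 2) := by
          rw [h1]
          nlinarith
        exact le_of_mul_le_mul_left h4 (by positivity)

/-! ### Reduction to the plane. -/

lemma realPoint_injective : Function.Injective realPoint := by
  rintro ⟨x, y⟩ ⟨x', y'⟩ h
  simpa [realPoint] using h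

lemma intPoint_injective {d : ℕ} : Function.Injective (intPoint (d := d)) := by
  intro x y h
  ext i
  exact Int.cast_injective (α := ℝ) (congrFun h i)

lemma mem_span_basisFun_iff {d : ℕ} (x : Fin d → ℝ) :
    x ∈ Submodule.span ℤ (Set.range (Pi.basisFun ℝ (Fin d))) ↔ ∃ z : Fin d → ℤ, x = intPoint z := by
  rw [Module.Basis.mem_span_iff_repr_mem]
  constructor
  · intro h
    choose z hz using h
    refine ⟨z, funext fun i => ?_⟩
    have := hz i
    simp only [Pi.basisFun_repr] at this
    rw [← this]
    rfl
  · rintro ⟨z, rfl⟩ i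
    exact ⟨z i, by simp [intPoint]⟩

/-- Coordinates on a rational plane in which the lattice points are those of `ℤ²`. -/
lemma exists_lattice_coordinates {d : ℕ} {E : Submodule ℝ (Fin d → ℝ)}
    (hE : Module.finrank ℝ E = 2) {S : Set (Fin d → ℤ)}
    (hS : E = Submodule.span ℝ (intPoint '' S)) :
    ∃ φ : ℝ × ℝ →ₗ[ℝ] (Fin d → ℝ), Function.Injective φ ∧ LinearMap.range φ = E ∧
      ∀ x, (∃ z, φ x = intPoint z) ↔ ∃ v, x = realPoint v := by
  let L₀ : Submodule ℤ (Fin d → ℝ) := Submodule.span ℤ (Set.range (Pi.basisFun ℝ (Fin d)))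
  let L : Submodule ℤ E := ZLattice.comap ℝ L₀ E.subtype
  have : DiscreteTopology L :=
    ZLattice.comap_discreteTopology ℝ L₀ continuous_subtype_val Subtype.val_injective
  -- `E` is spanned by integer vectors, so its lattice points have full rank and a `ℤ`-basis of them
  -- is an `ℝ`-basis of `E`.
  have : IsZLattice ℝ L := by
    refine ⟨?_⟩
    apply Submodule.map_injective_of_injective E.injective_subtype
    rw [Submodule.map_span, Submodule.map_top, Submodule.range_subtype]
    refine le_antisymm (Submodule.span_le.mpr ?_) ?_
    · rintro _ ⟨x, -, rfl⟩; exact x.2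
    · conv_lhs => rw [hS]
      refine Submodule.span_mono ?_
      rintro _ ⟨z, hz, rfl⟩
      have hzE : intPoint z ∈ E := by rw [hS]; exact Submodule.subset_span ⟨z, hz, rfl⟩
      exact ⟨⟨_, hzE⟩, (mem_span_basisFun_iff _).mpr ⟨z, rfl⟩, rfl⟩
  have : Module.Finite ℤ L := ZLattice.module_finite ℝ L
  have : Module.Free ℤ L := ZLattice.module_free ℝ L
  have hrank : Module.finrank ℤ L = 2 := by rw [ZLattice.rank ℝ L, hE]
  let B := (Module.finBasisOfFinrankEq ℤ L hrank).ofZLatticeBasis ℝ L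
  have hBL : ∀ x : E, x ∈ L ↔ ∀ i, B.repr x i ∈ Set.range (algebraMap ℤ ℝ) := by
    intro x
    rw [← Module.Basis.mem_span_iff_repr_mem, Module.Basis.ofZLatticeBasis_span]
  let e : (ℝ × ℝ) ≃ₗ[ℝ] E := (LinearEquiv.finTwoArrow ℝ ℝ).symm ≪≫ₗ B.equivFun.symm
  have he₀ : ∀ x, B.repr (e x) 0 = x.1 := fun x => by
    have : B.equivFun (e x) = (LinearEquiv.finTwoArrow ℝ ℝ).symm x :=
      B.equivFun.apply_symm_apply _
    exact congrFun this 0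
  have he₁ : ∀ x, B.repr (e x) 1 = x.2 := fun x => by
    have : B.equivFun (e x) = (LinearEquiv.finTwoArrow ℝ ℝ).symm x :=
      B.equivFun.apply_symm_apply _
    exact congrFun this 1
  refine ⟨E.subtype ∘ₗ e.toLinearMap, Subtype.val_injective.comp e.injective, ?_, fun x => ?_⟩
  · rw [LinearMap.range_comp, LinearEquiv.range, Submodule.map_top, Submodule.range_subtype]
  · have h₁ : (∃ z, (E.subtype ∘ₗ e.toLinearMap) x = intPoint z) ↔ e x ∈ L :=
      (mem_span_basisFun_iff _).symm
    rw [h₁, hBL, Fin.forall_fin_two, he₀, he₁]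
    constructor
    · rintro ⟨⟨m, hm⟩, ⟨k, hk⟩⟩
      exact ⟨(m, k), Prod.ext hm.symm hk.symm⟩
    · rintro ⟨v, rfl⟩
      exact ⟨⟨v.1, rfl⟩, ⟨v.2, rfl⟩⟩

/-- With `0 ∈ V` and no triangle, all cross products vanish and `V` spans at most a line. -/
lemma hasTriangle_of_finrank_span {V : Finset (ℤ × ℤ)} (h0 : (0 : ℤ × ℤ) ∈ V)
    (hV : Module.finrank ℝ (Submodule.span ℝ (realPoint '' (V : Set (ℤ × ℤ)))) = 2) :
    HasTriangle V := by
  by_contra hc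
  have hcross : ∀ v ∈ V, ∀ w ∈ V, v.1 * w.2 = v.2 * w.1 := by
    intro v hv w hw
    by_contra hne
    exact hc ⟨0, h0, v, hv, w, hw, by simpa [sub_eq_zero] using hne⟩
  obtain ⟨p, hp⟩ : ∃ p : ℝ × ℝ,
      Submodule.span ℝ (realPoint '' (V : Set (ℤ × ℤ))) ≤ Submodule.span ℝ {p} := by
    by_cases hz : ∃ v ∈ V, v ≠ 0
    · obtain ⟨v, hv, hv0⟩ := hz
      refine ⟨realPoint v, Submodule.span_le.mpr ?_⟩
      rintro _ ⟨w, hw, rfl⟩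
      have hR : (v.1 : ℝ) * w.2 = v.2 * w.1 := by exact_mod_cast hcross v hv w hw
      rw [SetLike.mem_coe, Submodule.mem_span_singleton]
      by_cases hv1 : v.1 = 0
      · have hv2 : v.2 ≠ 0 := fun h => hv0 (Prod.ext hv1 h)
        have hv2R : (v.2 : ℝ) ≠ 0 := by exact_mod_cast hv2
        refine ⟨w.2 / v.2, Prod.ext ?_ ?_⟩
        · simp only [realPoint, Prod.smul_mk, smul_eq_mul]; field_simp; linarith
        · simp only [realPoint, Prod.smul_mk, smul_eq_mul]; field_simp
      · have hv1R : (v.1 : ℝ) ≠ 0 := by exact_mod_cast hv1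
        refine ⟨w.1 / v.1, Prod.ext ?_ ?_⟩
        · simp only [realPoint, Prod.smul_mk, smul_eq_mul]; field_simp
        · simp only [realPoint, Prod.smul_mk, smul_eq_mul]; field_simp; linarith
    · push Not at hz
      refine ⟨0, Submodule.span_le.mpr ?_⟩
      rintro _ ⟨w, hw, rfl⟩
      rw [hz w hw]
      simp [realPoint]
  have h₁ := Submodule.finrank_mono hp
  have h₂ : Module.finrank ℝ (Submodule.span ℝ {p}) ≤ 1 := by
    simpa using finrank_span_le_card (R := ℝ) ({p} : Set (ℝ × ℝ))
  omega

/-- Krein–Milman; no closure is needed, as there are only finitely many extreme points. -/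
lemma IsLatticePolytope.exists_eq_convexHull {d : ℕ} {P : Set (Fin d → ℝ)}
    (hP : IsLatticePolytope P) :
    ∃ S : Set (Fin d → ℤ), S.Finite ∧ P = convexHull ℝ (intPoint '' S) := by
  obtain ⟨⟨T, hT, rfl⟩, hext⟩ := hP
  have hfin : ((convexHull ℝ T).extremePoints ℝ).Finite := hT.subset extremePoints_convexHull_subset
  have hKM := closure_convexHull_extremePoints (hT.isCompact_convexHull ℝ) (convex_convexHull ℝ T)
  rw [(hfin.isClosed_convexHull ℝ).closure_eq] at hKM
  have himage : intPoint '' (intPoint ⁻¹' (convexHull ℝ T).extremePoints ℝ)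
      = (convexHull ℝ T).extremePoints ℝ := by
    rw [Set.image_preimage_eq_iff]
    intro v hv
    obtain ⟨z, rfl⟩ := hext v hv
    exact ⟨z, rfl⟩
  exact ⟨_, hfin.preimage intPoint_injective.injOn, by rw [himage, hKM]⟩

/-- A two-dimensional lattice polytope has the lattice point counts of a polygon in the plane. -/
lemma IsLatticePolytope.exists_planarCount_eq {d : ℕ} {P : Set (Fin d → ℝ)}
    (hP : IsLatticePolytope P) (hdim : polytopeDim P = 2) :
    ∃ V : Finset (ℤ × ℤ), HasTriangle V ∧ ∀ n, latticePointCount P n = planarCount V n := by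
  classical
  obtain ⟨S, hS, rfl⟩ := hP.exists_eq_convexHull
  have hne : S.Nonempty := by
    rw [Set.nonempty_iff_ne_empty]
    rintro rfl
    rw [polytopeDim, Set.image_empty, convexHull_empty, vectorSpan_empty, finrank_bot] at hdim
    omega
  obtain ⟨z₀, hz₀⟩ := hne
  obtain ⟨E, hE⟩ : ∃ E, E = vectorSpan ℝ (convexHull ℝ (intPoint '' S)) := ⟨_, rfl⟩
  have hspan : E = Submodule.span ℝ (intPoint '' ((fun z => z - z₀) '' S)) := by
    rw [hE, ← direction_affineSpan, affineSpan_convexHull, direction_affineSpan,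
      vectorSpan_eq_span_vsub_set_right ℝ (Set.mem_image_of_mem intPoint hz₀), Set.image_image,
      Set.image_image]
    congr 2
    ext z
    simp [intPoint]
  have hfr : Module.finrank ℝ E = 2 := by rw [hE]; exact hdim
  obtain ⟨φ, hφ, hrange, hlat⟩ := exists_lattice_coordinates hfr hspan
  have hcoord : ∀ z ∈ S, ∃ v, φ (realPoint v) = intPoint z - intPoint z₀ := by
    intro z hz
    have hsub : intPoint z - intPoint z₀ = intPoint (z - z₀) := by ext i; simp [intPoint]
    have hmem : intPoint (z - z₀) ∈ E := by
      rw [hspan]; exact Submodule.subset_span ⟨_, ⟨z, hz, rfl⟩, rfl⟩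
    rw [← hrange] at hmem
    obtain ⟨x, hx⟩ := hmem
    obtain ⟨v, rfl⟩ := (hlat x).mp ⟨_, hx⟩
    exact ⟨v, by rw [hx, hsub]⟩
  choose! f hf using hcoord
  have hlift : ∀ v, ∃ z, φ (realPoint v) = intPoint z := fun v => (hlat _).mpr ⟨v, rfl⟩
  choose ψ hψ using hlift
  obtain ⟨V, hVdef⟩ : ∃ V : Finset (ℤ × ℤ), V = hS.toFinset.image f := ⟨_, rfl⟩
  have hφV : φ '' (realPoint '' (V : Set (ℤ × ℤ))) = intPoint '' ((fun z => z - z₀) '' S) := by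
    rw [hVdef, Finset.coe_image, Set.Finite.coe_toFinset, Set.image_image, Set.image_image,
      Set.image_image]
    refine Set.image_congr fun z hz => ?_
    rw [hf z hz]
    ext i
    simp [intPoint]
  -- Translating by the lattice point `z₀` puts the polygon in the linear plane `E`; the `n`-th
  -- dilate is then translated by `n z₀`, again a lattice vector.
  have hPeq : convexHull ℝ (intPoint '' S) = intPoint z₀ +ᵥ φ '' planarHull V := by
    rw [planarHull, φ.image_convexHull, hφV, ← convexHull_vadd]
    congr 1
    rw [← Set.image_vadd, Set.image_image, Set.image_image]
    refine Set.image_congr fun z hz => ?_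
    ext i
    simp [intPoint]
  refine ⟨V, hasTriangle_of_finrank_span ?_ ?_, fun n => ?_⟩
  · have h0 : f z₀ = 0 := by
      apply realPoint_injective
      apply hφ
      rw [hf z₀ hz₀, sub_self, show realPoint 0 = 0 by simp [realPoint], map_zero]
    rw [hVdef, ← h0]
    exact Finset.mem_image_of_mem f (hS.mem_toFinset.mpr hz₀)
  · rw [← hfr, hspan, ← hφV, ← Submodule.map_span]
    exact (Submodule.equivMapOfInjective φ hφ _).finrank_eq
  · have hset : {z : Fin d → ℤ | intPoint z ∈ (n : ℝ) • convexHull ℝ (intPoint '' S)}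
        = (fun v => (n : ℤ) • z₀ + ψ v) '' {v | realPoint v ∈ (n : ℝ) • planarHull V} := by
      have hadd : ∀ v, intPoint ((n : ℤ) • z₀ + ψ v)
          = (n : ℝ) • intPoint z₀ + φ (realPoint v) := by
        intro v
        rw [hψ]
        ext i
        simp [intPoint]
      ext z
      rw [hPeq]
      constructor
      · rintro ⟨_, ⟨_, ⟨x, hx, rfl⟩, rfl⟩, hz⟩
        simp only [vadd_eq_add, smul_add, ← map_smul] at hz
        have hint : φ ((n : ℝ) • x) = intPoint (z - (n : ℤ) • z₀) := by
          rw [← add_right_inj ((n : ℝ) • intPoint z₀), hz]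
          ext i
          simp [intPoint]
        obtain ⟨v, hv⟩ := (hlat _).mp ⟨_, hint⟩
        refine ⟨v, ⟨x, hx, hv⟩, intPoint_injective ?_⟩
        rw [hadd, ← hv, hz]
      · rintro ⟨v, ⟨x, hx, hv⟩, rfl⟩
        refine ⟨_, ⟨_, ⟨x, hx, rfl⟩, rfl⟩, ?_⟩
        simp only [vadd_eq_add, smul_add, ← map_smul] at hv ⊢
        rw [hadd, ← hv]
    have hinj : Function.Injective (fun v => (n : ℤ) • z₀ + ψ v) := by
      intro v w hvw
      have : ψ v = ψ w := add_left_cancel hvw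
      exact realPoint_injective (hφ (by rw [hψ, hψ, this]))
    rw [latticePointCount, hset, Set.ncard_image_of_injective _ hinj, planarCount]

lemma IsEhrhartPolynomial.unique {d : ℕ} {P : Set (Fin d → ℝ)} {p q : Polynomial ℂ}
    (hp : IsEhrhartPolynomial P p) (hq : IsEhrhartPolynomial P q) : p = q := by
  apply Polynomial.eq_of_infinite_eval_eq
  refine (Set.infinite_range_of_injective (Nat.cast_injective (R := ℂ))).mono ?_
  rintro _ ⟨n, rfl⟩
  exact (hp n).trans (hq n).symm

theorem theorem2p2 {d : ℕ} (P : Set (Fin d → ℝ)) (hP : IsLatticePolytope P)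
    (hdim : polytopeDim P = 2) :
    (∃! p : Polynomial ℂ, IsEhrhartPolynomial P p) ∧
      ∀ p : Polynomial ℂ, IsEhrhartPolynomial P p → ∀ z : ℂ, p.IsRoot z →
        z ∈ ({-2, -1, -2 / 3} : Set ℂ) ∪
          {w : ℂ | -1 / 2 ≤ w.re ∧ w.re < 0 ∧ |w.im| ≤ Real.sqrt 15 / 6} := by
  obtain ⟨V, hV, hcount⟩ := hP.exists_planarCount_eq hdim
  obtain ⟨k, i, hk, hki, hpoly⟩ := exists_planarCount_eq hV
  obtain ⟨A, hA⟩ : ∃ A : ℝ, A = i + k / 2 - 1 := ⟨_, rfl⟩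
  obtain ⟨p₀, hp₀⟩ : ∃ p₀ : Polynomial ℂ, ∀ z,
      p₀.eval z = (A : ℂ) * z ^ 2 + ((k / 2 : ℝ) : ℂ) * z + 1 :=
    ⟨.C (A : ℂ) * .X ^ 2 + .C ((k / 2 : ℝ) : ℂ) * .X + 1, fun z => by simp⟩
  have hE : IsEhrhartPolynomial P p₀ := by
    intro n
    rw [hp₀, hcount]
    have := hpoly n
    rw [← hA] at this
    exact_mod_cast (congrArg (fun x : ℝ => (x : ℂ)) this).symm
  refine ⟨⟨p₀, hE, fun q hq => hq.unique hE⟩, fun p hp z hz => ?_⟩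
  obtain rfl := hp.unique hE
  rw [Polynomial.IsRoot, hp₀] at hz
  exact mem_rootRegion_of_quadratic hk hki hA hz
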